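/- An instance of delegated stochastic probing consists of a finite ground set $E$, mutually independent pairs $(X_e,Y_e)_{e\in E}$ with $(X_e,Y_e)\sim\mu_e$ taking values in $\mathbb R_{\ge 0}\times\mathbb R_{\ge 0}$ (the utilities of element $e$ for the principal and for the agent), and two downwards-closed set systems on $E$, the outer and the inner constraint. An outcome is a triple $(e,x,y)$ with $(x,y)\in\operatorname{supp}(\mu_e)$. A deterministic policy is a family $\mathcal R$ of (acceptable) sets of outcomes with distinct elements, whose set of elements is feasible for the inner constraint. Knowing $\mathcal R$, the agent adaptively probes elements (each at most once, the probed set being feasible for the outer constraint), observes the outcomes $S$ of the probed elements, and proposes a set $T$ of outcomes. If $T\in\mathcal R$ and $T\subseteq S$, the solution is $T$; otherwise it is $\emptyset$. A solution $T$ gives the principal $\sum_{(e,x,y)\in T}x$ and the agent $\sum_{(e,x,y)\in T}y$. The agent uses a strategy that maximizes his expected utility; when indifferent, he does not leave out elements, i.e. almost surely his solution is not properly contained in an acceptable set of realized outcomes all of whose elements he has probed or could still probe in addition within the outer constraint. All remaining ties may be broken adversarially. For $\alpha\in[0,1]$, $\mathcal R$ is an $\alpha$-policy if, for every such strategy of the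 agent, the expected utility of the principal is at least $\alpha$ times that of an optimal adaptive non-delegating principal, who probes subject to the outer constraint and then takes, among the inner-feasible sets $G$ of probed elements, one that maximizes $\sum_{e\in G}X_e$. (Expectations are in $[0,\infty]$.) Corollary. Consider an instance with no outer constraint (every subset of $E$ is feasible for the outer constraint). 1. If the inner constraint is a matroid constraint (the feasible sets are the independent sets of a matroid on $E$), then there is a deterministic $\frac14$-policy. 2. If the inner constraint is a matching constraint ($E$ is the edge set of a graph, not necessarily bipartite, and the feasible sets are the matchings), then there is a deterministic $\frac1{2e}$-policy. 3. If the inner constraint is a knapsack constraint (the feasible sets are the $T\subseteq E$ with $\sum_{e\in T}s_e\le c$, for given sizes $s_e\ge 0$ and a capacity $c\ge 0$), then there is a deterministic $\left(\frac32-\sqrt2\right)$-policy. -/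

import Mathlib

open MeasureTheory
open scoped NNReal ENNReal

namespace DelegatedProbing

universe u v

/-- A downwards-closed set system on the finite ground set `E`. -/
@[ext]
structure SetSystem (E : Type u) where
  feasible : Finset E → Prop
  empty_feasible : feasible ∅
  down_closed : ∀ ⦃S T : Finset E⦄, S ⊆ T → feasible T → feasible S

/-- The trivial set system, in which every set is feasible (absence of a constraint). -/
def trivialSystem (E : Type u) : SetSystem E where
  feasible _ := True
  empty_feasible := True.intro
  down_closed _ _ _ _ := True.intro

/-- The matroid constraint: the feasible sets are the independent sets of `M`. -/
def matroidSystem {E : Type u} (M : Matroid E) : SetSystem E where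
  feasible T := M.Indep (T : Set E)
  empty_feasible := by simp
  down_closed _ _ hST hT := hT.subset (Finset.coe_subset.2 hST)

/-- The matching constraint. The elements are the edges of a multigraph on the vertex set `V`
with end points `ends`; the feasible sets are the matchings, that is, the sets of edges that
are not loops and no two of which share a vertex. -/
def matchingSystem {E : Type u} {V : Type v} (ends : E → Sym2 V) : SetSystem E where
  feasible T := (∀ e ∈ T, ¬ (ends e).IsDiag) ∧
    ∀ e ∈ T, ∀ f ∈ T, e ≠ f → ∀ w : V, w ∈ ends e → w ∉ ends f
  empty_feasible := by simp
  down_closed _ _ hST hT :=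
    ⟨fun e he => hT.1 e (hST he), fun e he f hf => hT.2 e (hST he) f (hST hf)⟩

/-- The knapsack constraint with sizes `size` and capacity `cap`. -/
def knapsackSystem {E : Type u} (size : E → ℝ≥0) (cap : ℝ≥0) : SetSystem E where
  feasible T := ∑ e ∈ T, size e ≤ cap
  empty_feasible := by simp
  down_closed _ _ hST hT := (Finset.sum_le_sum_of_subset hST).trans hT

/-- An outcome `(e, x, y)`: an element with its utilities for the principal and the agent. -/
abbrev Outcome (E : Type u) := E × (ℝ≥0 × ℝ≥0)

/-- A realization of the utility pairs `(X_e, Y_e)` of all elements. -/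
abbrev Realization (E : Type u) := E → ℝ≥0 × ℝ≥0

/-- `x(T)`, the total utility of the outcomes in `T` for the principal. -/
def xval {E : Type u} (T : Finset (Outcome E)) : ℝ≥0 := ∑ o ∈ T, o.2.1

/-- `y(T)`, the total utility of the outcomes in `T` for the agent. -/
def yval {E : Type u} (T : Finset (Outcome E)) : ℝ≥0 := ∑ o ∈ T, o.2.2

open Classical in
/-- The set of elements that occur in a set of outcomes. -/
noncomputable def elements {E : Type u} (T : Finset (Outcome E)) : Finset E :=
  T.image Prod.fst

open Classical in
/-- The outcomes of the elements in `F` under the realization `ω`. -/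
noncomputable def outcomesOf {E : Type u} (F : Finset E) (ω : Realization E) :
    Finset (Outcome E) :=
  F.image fun e => (e, ω e)

/-- A (deterministic) adaptive probing algorithm, as a decision tree: either finish, or probe an
element and continue depending on the utility pair that is observed. -/
inductive ProbingAlgorithm (E : Type u) : Type u
  | done : ProbingAlgorithm E
  | probe (e : E) (next : ℝ≥0 × ℝ≥0 → ProbingAlgorithm E) : ProbingAlgorithm E

open Classical in
/-- The set of elements that a probing algorithm probes under the realization `ω`. -/
noncomputable def ProbingAlgorithm.probed {E : Type u} :
    ProbingAlgorithm E → Realization E → Finset E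
  | .done, _ => ∅
  | .probe e next, ω => insert e ((next (ω e)).probed ω)

open Classical in
/-- After the elements of `F` have been probed, the algorithm never probes an element twice and
keeps the set of probed elements feasible in `M`. -/
def ProbingAlgorithm.FeasibleFrom {E : Type u} (M : SetSystem E) :
    ProbingAlgorithm E → Finset E → Prop
  | .done, _ => True
  | .probe e next, F =>
      e ∉ F ∧ M.feasible (insert e F) ∧ ∀ z, (next z).FeasibleFrom M (insert e F)

/-- An instance of delegated stochastic probing: the distributions of the utility pairs of the
elements, the outer constraint and the inner constraint. -/
structure ProbingInstance (E : Type u) where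
  μ : E → Measure (ℝ≥0 × ℝ≥0)
  isProb : ∀ e, IsProbabilityMeasure (μ e)
  outer : SetSystem E
  inner : SetSystem E

namespace ProbingInstance

variable {E : Type u} [Fintype E]

/-- The joint law of the utility pairs, which are independent across elements. -/
noncomputable def law (I : ProbingInstance E) : Measure (Realization E) :=
  Measure.pi I.μ

/-- `a` is a probing algorithm for `I`: it respects the outer constraint, and the set of probed
elements is a random variable. -/
def IsProbing (I : ProbingInstance E) (a : ProbingAlgorithm E) : Prop :=
  a.FeasibleFrom I.outer ∅ ∧ ∀ F : Finset E, MeasurableSet {ω | a.probed ω = F}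

open Classical in
/-- `u(F)`: the maximum of `x(G)` over the inner-feasible `G ⊆ F`. -/
noncomputable def u (I : ProbingInstance E) (F : Finset E) (ω : Realization E) : ℝ≥0 :=
  (F.powerset.filter I.inner.feasible).sup fun G => ∑ e ∈ G, (ω e).1

/-- The expected utility of an optimal adaptive non-delegating principal. -/
noncomputable def nonDelegatedValue (I : ProbingInstance E) : ℝ≥0∞ :=
  ⨆ (a : ProbingAlgorithm E) (_ : I.IsProbing a), ∫⁻ ω, (I.u (a.probed ω) ω : ℝ≥0∞) ∂I.law

/-- `Ω_in`: the sets of outcomes (with utilities in the supports of the distributions) whose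
elements are distinct and form a feasible set of the inner constraint. -/
def OmegaIn (I : ProbingInstance E) : Set (Finset (Outcome E)) :=
  {T | (∀ o ∈ T, o.2 ∈ (I.μ o.1).support) ∧
    Set.InjOn Prod.fst (T : Set (Outcome E)) ∧ I.inner.feasible (elements T)}

/-- A deterministic (single-proposal) policy: a family `R ⊆ Ω_in` of acceptable sets of outcomes,
such that acceptability of the outcomes of any given set of elements is an event. -/
def IsPolicy (I : ProbingInstance E) (R : Set (Finset (Outcome E))) : Prop :=
  R ⊆ I.OmegaIn ∧ ∀ G : Finset E, MeasurableSet {ω | outcomesOf G ω ∈ R}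

end ProbingInstance

/-- A strategy of the agent: an adaptive probing algorithm, and the set of outcomes that is
proposed to the principal as a function of the set of observed outcomes. -/
structure AgentStrategy (E : Type u) where
  algo : ProbingAlgorithm E
  propose : Finset (Outcome E) → Finset (Outcome E)

open Classical in
/-- The solution that results from the strategy `s` under the policy `R`: the proposed set if it
is acceptable and consists of observed outcomes, and the null solution otherwise. -/
noncomputable def AgentStrategy.result {E : Type u} (s : AgentStrategy E)
    (R : Set (Finset (Outcome E))) (ω : Realization E) : Finset (Outcome E) :=
  let S := outcomesOf (s.algo.probed ω) ω
  if s.propose S ∈ R ∧ s.propose S ⊆ S then s.propose S else ∅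

namespace ProbingInstance

variable {E : Type u} [Fintype E]

/-- The expected utility of the principal. -/
noncomputable def principalValue (I : ProbingInstance E) (R : Set (Finset (Outcome E)))
    (s : AgentStrategy E) : ℝ≥0∞ :=
  ∫⁻ ω, (xval (s.result R ω) : ℝ≥0∞) ∂I.law

/-- The expected utility of the agent. -/
noncomputable def agentValue (I : ProbingInstance E) (R : Set (Finset (Outcome E)))
    (s : AgentStrategy E) : ℝ≥0∞ :=
  ∫⁻ ω, (yval (s.result R ω) : ℝ≥0∞) ∂I.law

/-- `s` is an admissible strategy against `R`: it probes within the outer constraint, and its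
resulting solution is a random variable. -/
def IsStrategy (I : ProbingInstance E) (R : Set (Finset (Outcome E)))
    (s : AgentStrategy E) : Prop :=
  I.IsProbing s.algo ∧ ∀ G : Finset E, MeasurableSet {ω | s.result R ω = outcomesOf G ω}

/-- `s` maximizes the expected utility of the agent over all adaptive strategies. -/
def IsBestResponse (I : ProbingInstance E) (R : Set (Finset (Outcome E)))
    (s : AgentStrategy E) : Prop :=
  I.IsStrategy R s ∧ ∀ s', I.IsStrategy R s' → I.agentValue R s' ≤ I.agentValue R s

open Classical in
/-- Almost surely, the resulting solution is not properly contained in an acceptable set of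
outcomes all of whose elements have been probed, or could still be probed in addition within the
outer constraint. (As utilities are nonnegative, enlarging a solution never hurts the agent; this
only restricts how the agent resolves indifference.) -/
def IsThorough (I : ProbingInstance E) (R : Set (Finset (Outcome E)))
    (s : AgentStrategy E) : Prop :=
  ∀ᵐ ω ∂I.law, ∀ T ∈ R, T ⊆ outcomesOf Finset.univ ω →
    I.outer.feasible (s.algo.probed ω ∪ elements T) → ¬ s.result R ω ⊂ T

/-- `R` is a deterministic `α`-policy: whichever optimal (thorough) strategy the agent uses, so
with all remaining ties broken adversarially, the expected utility of the principal is at least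
`α` times that of an optimal non-delegating principal. -/
def IsAlphaPolicy (I : ProbingInstance E) (α : ℝ) (R : Set (Finset (Outcome E))) : Prop :=
  I.IsPolicy R ∧ ∀ s : AgentStrategy E, I.IsBestResponse R s → I.IsThorough R s →
    ENNReal.ofReal α * I.nonDelegatedValue ≤ I.principalValue R s

end ProbingInstance

end DelegatedProbing

/-! Without an outer constraint the non-delegating principal may as well see every realization and
take a best feasible set `g ω`. The law of `g` is a distribution `lam` on feasible sets. Put p_e =
P(e ∈ g) (this is `coverProb`) and v_e = E[X_e; e ∈ g], so the benchmark is at most the sum of the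
v_e.

Let Q_e(z) be the conditional probability of e ∈ g given that e realizes z, and activate each e
independently with probability r_e Q_e(z). The activity of e then has probability r_e p_e, and the
active part of X_e has expectation r_e v_e. Fix a family F of feasible sets. Call e selectable if it
can be added to every member of F that consists of active elements. This does not depend on whether
e itself is active, so the expected value of the active selectable elements is the sum of r_e v_e
P(e selectable) (`lintegral_sum_subsetWeight_mul_sum`). That value is affine in each activation
probability, so the probabilities can be rounded to 0 or 1 one element at a time without loss,
giving sets B_e of acceptable utility pairs (`exists_measurableSet_le_lintegral`).

The policy accepts the sets in F whose outcomes lie in the B_e. A thorough agent's solution is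
almost surely maximal among the realized acceptable sets. It therefore contains every active
selectable element, whatever the tie-breaking (`lintegral_selectable_le_principalValue`). This
reduces the theorem to greedy contention resolution (`exists_isAlphaPolicy`): find r and F making
r_e P(e selectable) large, for p in the convex hull of the feasible sets.

For matchings, F consists of all matchings and independence bounds the chance that no neighbouring
edge is active. For a knapsack, F holds either single big items or sets of small items, with
Markov's inequality in both cases. For a matroid, F comes from a chain of subsets with independence
required in successive contractions (`exists_family_forall_le_selectProb`). -/

namespace DelegatedProbing

/-! ### Random subsets with independent membership, and selectability -/

section RandomSubset

open Classical in
/-- If the elements of `A` are active and the acceptable sets are those of `F`, then every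
acceptable set of active elements remains acceptable when `e` is added. -/
def Selectable {E : Type*} (F : Set (Finset E)) (e : E) (A : Finset E) : Prop :=
  ∀ I ∈ F, I ⊆ A → insert e I ∈ F

-- Only members of F that avoid e can obstruct e, and these do not notice whether e is active. Hence
-- the activity of e and its selectability are independent.
open Classical in
theorem selectable_insert {E : Type*} {F : Set (Finset E)} {e : E} {A : Finset E} :
    Selectable F e (insert e A) ↔ Selectable F e A := by
  refine ⟨fun h I hI hA => h I hI (hA.trans (Finset.subset_insert _ _)), fun h I hI hA => ?_⟩
  by_cases he : e ∈ I
  · rwa [Finset.insert_eq_of_mem he]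
  · exact h I hI ((Finset.subset_insert_iff_of_notMem he).1 hA)

variable {E : Type*} [Fintype E]

open Classical in
/-- The probability that the random set which contains each `e` independently with probability
`p e` equals `A`. -/
noncomputable def subsetWeight {R : Type*} [CommSemiring R] [Sub R] (p : E → R) (A : Finset E) : R :=
  ∏ e, if e ∈ A then p e else 1 - p e

open Classical in
theorem sum_prod_ite_mem {R : Type*} [CommSemiring R] (a b : E → R) :
    ∑ A : Finset E, ∏ e, (if e ∈ A then a e else b e) = ∏ e, (a e + b e) := by
  rw [Fintype.prod_add]
  refine Finset.sum_congr rfl fun A _ => ?_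
  rw [Finset.prod_ite]
  congr 1
  · exact Finset.prod_congr (by ext; simp) fun _ _ => rfl
  · exact Finset.prod_congr (by ext; simp) fun _ _ => rfl

theorem sum_subsetWeight (p : E → ℝ) : ∑ A, subsetWeight p A = 1 := by
  classical
  simp only [subsetWeight]
  rw [sum_prod_ite_mem]
  simp

theorem subsetWeight_nonneg {p : E → ℝ} (h0 : ∀ e, 0 ≤ p e) (h1 : ∀ e, p e ≤ 1) (A : Finset E) :
    0 ≤ subsetWeight p A := by
  refine Finset.prod_nonneg fun e _ => ?_
  split_ifs
  · exact h0 e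
  · linarith [h1 e]

theorem ofReal_subsetWeight {p : E → ℝ} (h0 : ∀ e, 0 ≤ p e) (h1 : ∀ e, p e ≤ 1) (A : Finset E) :
    ENNReal.ofReal (subsetWeight p A) = subsetWeight (fun e => ENNReal.ofReal (p e)) A := by
  unfold subsetWeight
  rw [ENNReal.ofReal_prod_of_nonneg]
  · refine Finset.prod_congr rfl fun e _ => ?_
    split_ifs
    · rfl
    · rw [ENNReal.ofReal_sub _ (h0 e), ENNReal.ofReal_one]
  · intro e _
    split_ifs
    · exact h0 e
    · linarith [h1 e]

open Classical in
theorem sum_subsetWeight_disjoint (p : E → ℝ) (D : Finset E) :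
    ∑ A with Disjoint A D, subsetWeight p A = ∏ e ∈ D, (1 - p e) := by
  have h : ∏ e ∈ D, (1 - p e) = ∏ e, ((if e ∈ D then 0 else p e) + (1 - p e)) := by
    rw [← Finset.prod_subset (Finset.subset_univ D)]
    · exact Finset.prod_congr rfl fun e he => by simp [he]
    · intro e _ he
      simp [he]
  rw [h, ← sum_prod_ite_mem, Finset.sum_filter]
  refine Finset.sum_congr rfl fun A _ => ?_
  split_ifs with hA
  · refine Finset.prod_congr rfl fun e _ => ?_
    by_cases he : e ∈ A
    · simp [he, Finset.disjoint_left.1 hA he]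
    · simp [he]
  · rw [Finset.not_disjoint_iff] at hA
    obtain ⟨e, he, he'⟩ := hA
    exact (Finset.prod_eq_zero (Finset.mem_univ e) (by simp [he, he'])).symm

open Classical in
theorem sum_subsetWeight_mem (p : E → ℝ) (e : E) :
    ∑ A with e ∈ A, subsetWeight p A = p e := by
  have h := sum_subsetWeight_disjoint p {e}
  have h' := Finset.sum_filter_add_sum_filter_not (s := Finset.univ) (fun A : Finset E => e ∈ A)
    (subsetWeight p)
  simp only [Finset.disjoint_singleton_right, Finset.prod_singleton] at h
  rw [h, sum_subsetWeight] at h'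
  linarith

open Classical in
theorem sum_subsetWeight_mul_sum (p w : E → ℝ) (D : Finset E) :
    ∑ A, subsetWeight p A * ∑ e ∈ A ∩ D, w e = ∑ e ∈ D, p e * w e := by
  simp_rw [Finset.inter_comm _ D, ← Finset.sum_ite_mem, Finset.mul_sum]
  rw [Finset.sum_comm]
  refine Finset.sum_congr rfl fun e _ => ?_
  rw [← sum_subsetWeight_mem p e, Finset.sum_mul, Finset.sum_filter]
  refine Finset.sum_congr rfl fun A _ => ?_
  split_ifs <;> simp


open Classical in
/-- The contribution to `subsetWeight` of the elements other than `e`. -/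
noncomputable def subsetWeightErase {R : Type*} [CommSemiring R] [Sub R] (p : E → R) (e : E)
    (A : Finset E) : R :=
  ∏ f ∈ Finset.univ.erase e, if f ∈ A then p f else 1 - p f

open Classical in
theorem subsetWeight_eq_mul {R : Type*} [CommSemiring R] [Sub R] (p : E → R) (e : E)
    (A : Finset E) :
    subsetWeight p A = (if e ∈ A then p e else 1 - p e) * subsetWeightErase p e A :=
  (Finset.mul_prod_erase _ _ (Finset.mem_univ e)).symm

theorem subsetWeightErase_congr {R : Type*} [CommSemiring R] [Sub R] {p p' : E → R} {e : E}
    (h : ∀ f, f ≠ e → p f = p' f) (A : Finset E) :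
    subsetWeightErase p e A = subsetWeightErase p' e A := by
  classical
  exact Finset.prod_congr rfl fun f hf => by rw [h f (Finset.ne_of_mem_erase hf)]

open Classical in
theorem sum_subsetWeight_mul {R : Type*} [CommSemiring R] [Sub R] (p : E → R) (e : E)
    (f : Finset E → R) :
    ∑ A, subsetWeight p A * f A =
      p e * ∑ A with e ∈ A, subsetWeightErase p e A * f A +
        (1 - p e) * ∑ A with e ∉ A, subsetWeightErase p e A * f A := by
  rw [← Finset.sum_filter_add_sum_filter_not (s := Finset.univ) (fun A : Finset E => e ∈ A),
    Finset.mul_sum, Finset.mul_sum]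
  congr 1
  · refine Finset.sum_congr rfl fun A hA => ?_
    rw [subsetWeight_eq_mul p e, if_pos (by simpa using hA), mul_assoc]
  · refine Finset.sum_congr rfl fun A hA => ?_
    rw [subsetWeight_eq_mul p e, if_neg (by simpa using hA), mul_assoc]

-- The coin of e is integrated out: toggling e pairs the sets with e and those without, and `f`
-- agrees on each pair. The hypothesis `hp` is needed because subtraction in `ℝ≥0∞` is truncated.
open Classical in
theorem sum_subsetWeight_mul_of_forall_insert {R : Type*} [CommSemiring R] [Sub R] {p : E → R}
    {e : E} (hp : p e + (1 - p e) = 1) {f : Finset E → R} (hf : ∀ A, f (insert e A) = f A) :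
    ∑ A, subsetWeight p A * f A = ∑ A with e ∈ A, subsetWeightErase p e A * f A := by
  have h : ∑ A with e ∉ A, subsetWeightErase p e A * f A =
      ∑ A with e ∈ A, subsetWeightErase p e A * f A := by
    refine Finset.sum_nbij' (insert e) (fun A => A.erase e) ?_ ?_ ?_ ?_ ?_
    · simp
    · simp
    · intro A hA
      exact Finset.erase_insert (by simpa using hA)
    · intro A hA
      exact Finset.insert_erase (by simpa using hA)
    · intro A _
      rw [hf]
      congr 1
      refine Finset.prod_congr rfl fun g hg => ?_
      simp [Finset.ne_of_mem_erase hg]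
  rw [sum_subsetWeight_mul p e, h, ← add_mul, hp, one_mul]

open Classical in
/-- The probability that `e` is selectable if each element `f` is independently active with
probability `p f`. -/
noncomputable def selectProb (p : E → ℝ) (F : Set (Finset E)) (e : E) : ℝ :=
  ∑ A with Selectable F e A, subsetWeight p A

end RandomSubset

/-! ### Rounding random activation to measurable acceptance sets -/

section Derandomization

variable {E Z : Type*} [Fintype E] [MeasurableSpace Z] {μ : E → Measure Z}
  [∀ e, IsProbabilityMeasure (μ e)]

-- Resampling coordinate e independently does not change the product law. This plays the role of
-- conditioning on the value at e.
open Classical in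
theorem lintegral_pi_eq_lintegral_update (e : E) {f : (E → Z) → ℝ≥0∞} (hf : Measurable f) :
    ∫⁻ ω, f ω ∂Measure.pi μ = ∫⁻ z, ∫⁻ ω, f (Function.update ω e z) ∂Measure.pi μ ∂μ e := by
  have hm : Measurable fun x : (E → Z) × Z => f (Function.update x.1 e x.2) :=
    hf.comp measurable_update'
  rw [← lintegral_lintegral_swap hm.aemeasurable]
  refine lintegral_eq_of_lmarginal_eq {e} hf hm.lintegral_prod_right' ?_
  simp only [lmarginal_singleton]
  ext ω
  simp

theorem measurable_subsetWeight {q : E → Z → ℝ≥0∞} (hq : ∀ e, Measurable (q e)) (A : Finset E) :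
    Measurable fun ω : E → Z => subsetWeight (fun e => q e (ω e)) A := by
  classical
  refine Finset.measurable_prod _ fun e _ => ?_
  split_ifs
  · exact (hq e).comp (measurable_pi_apply e)
  · exact measurable_const.sub ((hq e).comp (measurable_pi_apply e))

theorem measurable_subsetWeightErase {q : E → Z → ℝ≥0∞} (hq : ∀ e, Measurable (q e)) (e : E)
    (A : Finset E) :
    Measurable fun ω : E → Z => subsetWeightErase (fun e => q e (ω e)) e A := by
  classical
  refine Finset.measurable_prod _ fun e _ => ?_
  split_ifs
  · exact (hq e).comp (measurable_pi_apply e)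
  · exact measurable_const.sub ((hq e).comp (measurable_pi_apply e))

-- Conditionally on the value z at e, the objective is affine in `q e z`: the two inner integrals
-- involve `q` only at elements other than e.
open Classical in
theorem lintegral_sum_subsetWeight (e : E) {q : E → Z → ℝ≥0∞} (hq : ∀ e, Measurable (q e))
    {H : (E → Z) → Finset E → ℝ≥0∞} (hH : ∀ A, Measurable fun ω => H ω A) :
    ∫⁻ ω, ∑ A, subsetWeight (fun e => q e (ω e)) A * H ω A ∂Measure.pi μ =
      ∫⁻ z, (q e z * ∫⁻ ω, ∑ A with e ∈ A, subsetWeightErase (fun e => q e (ω e)) e A *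
          H (Function.update ω e z) A ∂Measure.pi μ +
        (1 - q e z) * ∫⁻ ω, ∑ A with e ∉ A, subsetWeightErase (fun e => q e (ω e)) e A *
          H (Function.update ω e z) A ∂Measure.pi μ) ∂μ e := by
  have hm (s : Finset (Finset E)) (z : Z) : Measurable fun ω : E → Z =>
      ∑ A ∈ s, subsetWeightErase (fun e => q e (ω e)) e A * H (Function.update ω e z) A :=
    Finset.measurable_sum _ fun A _ => (measurable_subsetWeightErase hq e A).mul
      ((hH A).comp measurable_update_left)
  have hm' : Measurable fun ω : E → Z =>
      ∑ A, subsetWeight (fun e => q e (ω e)) A * H ω A :=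
    Finset.measurable_sum _ fun A _ => (measurable_subsetWeight hq A).mul (hH A)
  rw [lintegral_pi_eq_lintegral_update e hm']
  refine lintegral_congr fun z => ?_
  rw [← lintegral_const_mul _ (hm _ z), ← lintegral_const_mul _ (hm _ z),
    ← lintegral_add_left ((hm _ z).const_mul _)]
  refine lintegral_congr fun ω => ?_
  rw [sum_subsetWeight_mul _ e]
  simp only [Function.update_self]
  have h (A : Finset E) :
      subsetWeightErase (fun f => q f (Function.update ω e z f)) e A =
        subsetWeightErase (fun f => q f (ω f)) e A :=
    subsetWeightErase_congr (fun f hf => by rw [Function.update_of_ne hf]) A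
  simp only [h]

/-- An affine function on [0,1] is largest at an end point, so for each z the better of "active" and
"inactive" is chosen. The set `B` where active is at least as good is measurable because both
coefficients are. -/
theorem exists_indicator_le_lintegral_sum_subsetWeight (e : E) {q : E → Z → ℝ≥0∞}
    (hq : ∀ e, Measurable (q e)) (hq1 : ∀ e z, q e z ≤ 1)
    {H : (E → Z) → Finset E → ℝ≥0∞} (hH : ∀ A, Measurable fun ω => H ω A) :
    ∃ q' : E → Z → ℝ≥0∞, (∀ e, Measurable (q' e)) ∧ (∀ e z, q' e z ≤ 1) ∧
      (∀ f, f ≠ e → q' f = q f) ∧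
      (∃ B, MeasurableSet B ∧ q' e = B.indicator fun _ => 1) ∧
      ∫⁻ ω, ∑ A, subsetWeight (fun e => q e (ω e)) A * H ω A ∂Measure.pi μ ≤
        ∫⁻ ω, ∑ A, subsetWeight (fun e => q' e (ω e)) A * H ω A ∂Measure.pi μ := by
  classical
  let K (s : Finset (Finset E)) (z : Z) : ℝ≥0∞ :=
    ∫⁻ ω, ∑ A ∈ s, subsetWeightErase (fun e => q e (ω e)) e A *
      H (Function.update ω e z) A ∂Measure.pi μ
  have hK (s : Finset (Finset E)) : Measurable (K s) := by
    have hm : Measurable fun x : Z × (E → Z) =>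
        ∑ A ∈ s, subsetWeightErase (fun e => q e (x.2 e)) e A *
          H (Function.update x.2 e x.1) A :=
      Finset.measurable_sum _ fun A _ =>
        ((measurable_subsetWeightErase hq e A).comp measurable_snd).mul
          ((hH A).comp (measurable_update'.comp measurable_swap))
    exact hm.lintegral_prod_right'
  let B : Set Z := {z | K {A | e ∉ A} z ≤ K {A | e ∈ A} z}
  have hB : MeasurableSet B := measurableSet_le (hK _) (hK _)
  refine ⟨Function.update q e (B.indicator fun _ => 1), ?_, ?_, ?_, ⟨B, hB, by simp⟩, ?_⟩
  · intro f
    by_cases hf : f = e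
    · subst hf
      simpa using measurable_const.indicator hB
    · simpa [hf] using hq f
  · intro f z
    by_cases hf : f = e
    · subst hf
      simpa using Set.indicator_le_self' (by simp) z
    · simpa [hf] using hq1 f z
  · intro f hf
    simp [hf]
  · rw [lintegral_sum_subsetWeight e hq hH, lintegral_sum_subsetWeight e ?_ hH]
    · refine lintegral_mono fun z => ?_
      have h (ω : E → Z) (A : Finset E) : subsetWeightErase
          (fun f => Function.update q e (B.indicator fun _ => 1) f (ω f)) e A =
          subsetWeightErase (fun f => q f (ω f)) e A :=
        subsetWeightErase_congr (fun f hf => by rw [Function.update_of_ne hf]) A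
      simp only [h, Function.update_self]
      change q e z * K _ z + (1 - q e z) * K _ z ≤
        B.indicator _ z * K _ z + (1 - B.indicator _ z) * K _ z
      have hsum : q e z + (1 - q e z) = 1 := add_tsub_cancel_of_le (hq1 e z)
      by_cases hz : z ∈ B
      · simp only [Set.indicator_of_mem hz, tsub_self, one_mul, zero_mul, add_zero]
        calc _ ≤ q e z * K {A | e ∈ A} z + (1 - q e z) * K {A | e ∈ A} z := by
              gcongr
              exact hz
          _ = _ := by rw [← add_mul, hsum, one_mul]
      · simp only [Set.indicator_of_notMem hz, tsub_zero, one_mul, zero_mul, zero_add]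
        calc _ ≤ q e z * K {A | e ∉ A} z + (1 - q e z) * K {A | e ∉ A} z := by
              gcongr
              exact (not_le.1 hz).le
          _ = _ := by rw [← add_mul, hsum, one_mul]
    · intro f
      by_cases hf : f = e
      · subst hf
        simpa using measurable_const.indicator hB
      · simpa [hf] using hq f

-- Rounding is applied to the elements successively. Once all probabilities are 0 or 1, the weight
-- sits on the single set of elements whose value lies in `B e`.
open Classical in
theorem exists_measurableSet_le_lintegral {q : E → Z → ℝ≥0∞}
    (hq : ∀ e, Measurable (q e)) (hq1 : ∀ e z, q e z ≤ 1)
    {H : (E → Z) → Finset E → ℝ≥0∞} (hH : ∀ A, Measurable fun ω => H ω A) :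
    ∃ B : E → Set Z, (∀ e, MeasurableSet (B e)) ∧
      ∫⁻ ω, ∑ A, subsetWeight (fun e => q e (ω e)) A * H ω A ∂Measure.pi μ ≤
        ∫⁻ ω, H ω {e | ω e ∈ B e} ∂Measure.pi μ := by
  have key (s : Finset E) : ∃ q' : E → Z → ℝ≥0∞, (∀ e, Measurable (q' e)) ∧
      (∀ e z, q' e z ≤ 1) ∧
      (∀ e ∈ s, ∃ B, MeasurableSet B ∧ q' e = B.indicator fun _ => 1) ∧
      ∫⁻ ω, ∑ A, subsetWeight (fun e => q e (ω e)) A * H ω A ∂Measure.pi μ ≤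
        ∫⁻ ω, ∑ A, subsetWeight (fun e => q' e (ω e)) A * H ω A ∂Measure.pi μ := by
    induction s using Finset.induction_on with
    | empty => exact ⟨q, hq, hq1, by simp, le_rfl⟩
    | insert e s _ ih =>
      obtain ⟨q₁, hm, hle, hB, h⟩ := ih
      obtain ⟨q₂, hm₂, hle₂, heq, hB₂, h₂⟩ :=
        exists_indicator_le_lintegral_sum_subsetWeight (μ := μ) e hm hle hH
      refine ⟨q₂, hm₂, hle₂, fun f hf => ?_, h.trans h₂⟩
      by_cases hfe : f = e
      · rwa [hfe]
      · rw [heq f hfe]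
        exact hB f ((Finset.mem_insert.1 hf).resolve_left hfe)
  obtain ⟨q', -, -, hB, h⟩ := key Finset.univ
  choose B hBm hBq using fun e => hB e (Finset.mem_univ e)
  refine ⟨B, hBm, h.trans_eq (lintegral_congr fun ω => ?_)⟩
  refine (Finset.sum_eq_single ({e | ω e ∈ B e} : Finset E) ?_ ?_).trans ?_
  rotate_left 2
  · suffices subsetWeight (fun e => q' e (ω e)) {e | ω e ∈ B e} = 1 by rw [this, one_mul]
    refine Finset.prod_eq_one fun e _ => ?_
    by_cases he : ω e ∈ B e <;> simp [hBq, he]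
  · intro A _ hA
    suffices subsetWeight (fun e => q' e (ω e)) A = 0 by rw [this, zero_mul]
    obtain ⟨e, he⟩ : ∃ e, ¬ (e ∈ A ↔ ω e ∈ B e) := by
      by_contra! hc
      exact hA (by ext e; simpa using hc e)
    refine Finset.prod_eq_zero (Finset.mem_univ e) ?_
    by_cases he' : e ∈ A
    · have : ω e ∉ B e := fun hc => he ⟨fun _ => hc, fun _ => he'⟩
      simp [he', hBq, this]
    · have : ω e ∈ B e := by tauto
      simp [he', hBq, this]
  · simp

theorem lintegral_pi_prod {f : E → Z → ℝ≥0∞} (hf : ∀ e, Measurable (f e)) :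
    ∫⁻ ω, ∏ e, f e (ω e) ∂Measure.pi μ = ∏ e, ∫⁻ z, f e z ∂μ e := by
  have h := ProbabilityTheory.iIndepFun_pi (μ := μ) (X := f) fun e => (hf e).aemeasurable
  rw [ProbabilityTheory.lintegral_prod_eq_prod_lintegral_of_indepFun _ _ h
    fun e => (hf e).comp (measurable_pi_apply e)]
  refine Finset.prod_congr rfl fun e _ => ?_
  rw [← lintegral_map (hf e) (measurable_pi_apply e), (measurePreserving_eval μ e).map_eq]

open Classical in
/-- The expected total value of the elements that are active and satisfy `σ`, if `e` is active with
probability `q e (ω e)` and `σ e` does not depend on whether `e` itself is active. -/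
theorem lintegral_sum_subsetWeight_mul_sum {q x : E → Z → ℝ≥0∞} (hq : ∀ e, Measurable (q e))
    (hq1 : ∀ e z, q e z ≤ 1) (hx : ∀ e, Measurable (x e)) {σ : E → Finset E → Prop}
    (hσ : ∀ e A, σ e (insert e A) ↔ σ e A) :
    ∫⁻ ω, ∑ A, subsetWeight (fun e => q e (ω e)) A *
        ∑ e ∈ A with σ e A, x e (ω e) ∂Measure.pi μ =
      ∑ e, (∫⁻ z, q e z * x e z ∂μ e) *
        ∑ A with σ e A, subsetWeight (fun e => ∫⁻ z, q e z ∂μ e) A := by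
  have hp (e : E) : ∫⁻ z, q e z ∂μ e ≤ 1 := by
    calc _ ≤ ∫⁻ _, 1 ∂μ e := lintegral_mono (hq1 e)
      _ = 1 := by simp
  have hsub (e : E) : ∫⁻ z, (1 - q e z) ∂μ e = 1 - ∫⁻ z, q e z ∂μ e := by
    rw [lintegral_sub (hq e) (ne_top_of_le_ne_top ENNReal.one_ne_top (hp e))
      (Filter.Eventually.of_forall (hq1 e))]
    simp
  have hm (e : E) (A : Finset E) :
      Measurable fun ω : E → Z => subsetWeight (fun e => q e (ω e)) A * x e (ω e) :=
    (measurable_subsetWeight hq A).mul ((hx e).comp (measurable_pi_apply e))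
  have hint (e : E) (A : Finset E) (he : e ∈ A) :
      ∫⁻ ω, subsetWeight (fun e => q e (ω e)) A * x e (ω e) ∂Measure.pi μ =
        (∫⁻ z, q e z * x e z ∂μ e) * subsetWeightErase (fun e => ∫⁻ z, q e z ∂μ e) e A := by
    -- For fixed `A` the integrand is a product of functions of single coordinates, with the factor
    -- `x e` attached to coordinate e.
    let g (f : E) (z : Z) : ℝ≥0∞ :=
      (if f ∈ A then q f z else 1 - q f z) * if f = e then x e z else 1
    have h1 (ω : E → Z) : subsetWeight (fun e => q e (ω e)) A * x e (ω e) =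
        ∏ f, g f (ω f) := by
      simp only [g]
      rw [Finset.prod_mul_distrib, Finset.prod_ite_eq']
      simp [subsetWeight]
    have hg (f : E) : Measurable (g f) := by
      refine Measurable.mul ?_ ?_
      · split_ifs
        · exact hq f
        · exact measurable_const.sub (hq f)
      · split_ifs
        · exact hx e
        · exact measurable_const
    simp_rw [h1]
    rw [lintegral_pi_prod hg, ← Finset.mul_prod_erase _ _ (Finset.mem_univ e)]
    congr 1
    · simp [g, he]
    · refine Finset.prod_congr rfl fun f hf => ?_
      simp only [g, Finset.ne_of_mem_erase hf, if_false, mul_one]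
      split_ifs
      · rfl
      · exact hsub f
  have hsw (ω : E → Z) : ∑ A, subsetWeight (fun e => q e (ω e)) A *
      ∑ e ∈ A with σ e A, x e (ω e) =
      ∑ e, ∑ A with e ∈ A ∧ σ e A, subsetWeight (fun e => q e (ω e)) A * x e (ω e) := by
    simp_rw [Finset.mul_sum]
    exact Finset.sum_comm' (by simp)
  simp_rw [hsw]
  rw [lintegral_finsetSum _ fun e _ => Finset.measurable_sum _ fun A _ => hm e A]
  refine Finset.sum_congr rfl fun e _ => ?_
  rw [lintegral_finsetSum _ fun A _ => hm e A]
  have hs := sum_subsetWeight_mul_of_forall_insert (p := fun e => ∫⁻ z, q e z ∂μ e) (e := e)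
    (f := fun A => if σ e A then 1 else 0) (add_tsub_cancel_of_le (hp e))
    (fun A => by simp only [hσ])
  have hs' : ∑ A with σ e A, subsetWeight (fun e => ∫⁻ z, q e z ∂μ e) A =
      ∑ A with e ∈ A ∧ σ e A, subsetWeightErase (fun e => ∫⁻ z, q e z ∂μ e) e A := by
    simpa [Finset.sum_filter, ite_and] using hs
  rw [hs', Finset.mul_sum]
  exact Finset.sum_congr rfl fun A hA => hint e A (Finset.mem_filter.1 hA).2.1

/-- A measurable choice of a maximizer among finitely many measurable functions. -/
theorem exists_measurable_argmax {Ω ι : Type*} [MeasurableSpace Ω] {s : Finset ι}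
    (hs : s.Nonempty) {f : ι → Ω → ℝ≥0} (hf : ∀ i, Measurable (f i)) :
    ∃ g : Ω → ι, (∀ i, MeasurableSet {ω | g ω = i}) ∧ (∀ ω, g ω ∈ s) ∧
      ∀ ω, ∀ i ∈ s, f i ω ≤ f (g ω) ω := by
  classical
  induction hs using Finset.Nonempty.cons_induction with
  | singleton a => exact ⟨fun _ => a, by simp, by simp, by simp⟩
  | cons a s ha hs ih =>
    obtain ⟨g, hg, hgs, hle⟩ := ih
    let C : Set Ω := {ω | ∀ i ∈ s, f i ω ≤ f a ω}
    have hC : MeasurableSet C := by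
      simp only [C, Set.ofPred_forall]
      exact MeasurableSet.biInter s.countable_toSet fun i _ => measurableSet_le (hf i) (hf a)
    refine ⟨fun ω => if ω ∈ C then a else g ω, fun i => ?_, fun ω => ?_, fun ω i hi => ?_⟩
    · have : {ω | (if ω ∈ C then a else g ω) = i} =
          (C ∩ {_ω | a = i}) ∪ (Cᶜ ∩ {ω | g ω = i}) := by
        ext ω
        by_cases h : ω ∈ C <;> simp [h]
      rw [this]
      exact (hC.inter (MeasurableSet.const _)).union (hC.compl.inter (hg i))
    · dsimp only
      split_ifs
      · simp
      · exact Finset.mem_cons_of_mem (hgs ω)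
    · dsimp only
      split_ifs with h
      · rcases Finset.mem_cons.1 hi with rfl | hi
        · exact le_rfl
        · exact h i hi
      · rcases Finset.mem_cons.1 hi with rfl | hi
        · obtain ⟨j, hj, hlt⟩ : ∃ j ∈ s, f i ω < f j ω := by
            by_contra! hc
            exact h hc
          exact hlt.le.trans (hle ω j hj)
        · exact hle ω i hi

end Derandomization

/-! ### From contention resolution to a delegation policy -/

section Policy

theorem mem_outcomesOf {E : Type*} {F : Finset E} {ω : Realization E} {o : Outcome E} :
    o ∈ outcomesOf F ω ↔ o.1 ∈ F ∧ o.2 = ω o.1 := by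
  classical
  unfold outcomesOf
  rw [Finset.mem_image]
  constructor
  · rintro ⟨e, he, rfl⟩
    exact ⟨he, rfl⟩
  · rintro ⟨h1, h2⟩
    exact ⟨o.1, h1, Prod.ext rfl h2.symm⟩

theorem mem_elements {E : Type*} {T : Finset (Outcome E)} {e : E} :
    e ∈ elements T ↔ ∃ o ∈ T, o.1 = e := by
  classical
  simp [elements]

theorem elements_outcomesOf {E : Type*} (F : Finset E) (ω : Realization E) :
    elements (outcomesOf F ω) = F := by
  ext e
  rw [mem_elements]
  constructor
  · rintro ⟨o, ho, rfl⟩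
    exact (mem_outcomesOf.1 ho).1
  · intro he
    exact ⟨(e, ω e), mem_outcomesOf.2 ⟨he, rfl⟩, rfl⟩

theorem injOn_fst_outcomesOf {E : Type*} (F : Finset E) (ω : Realization E) :
    Set.InjOn Prod.fst (outcomesOf F ω : Set (Outcome E)) := by
  intro o ho o' ho' h
  have h1 := (mem_outcomesOf.1 (Finset.mem_coe.1 ho)).2
  have h2 := (mem_outcomesOf.1 (Finset.mem_coe.1 ho')).2
  exact Prod.ext h (by rw [h1, h2, h])

theorem eq_outcomesOf_elements {E : Type*} {T : Finset (Outcome E)} {F : Finset E}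
    {ω : Realization E} (hT : T ⊆ outcomesOf F ω) : T = outcomesOf (elements T) ω := by
  ext o
  rw [mem_outcomesOf, mem_elements]
  constructor
  · intro ho
    exact ⟨⟨o, ho, rfl⟩, (mem_outcomesOf.1 (hT ho)).2⟩
  · rintro ⟨⟨o', ho', he⟩, h⟩
    have : o = o' := Prod.ext he.symm (by rw [h, (mem_outcomesOf.1 (hT ho')).2, he])
    rwa [this]

theorem outcomesOf_mono {E : Type*} {F G : Finset E} (h : F ⊆ G) (ω : Realization E) :
    outcomesOf F ω ⊆ outcomesOf G ω := fun _ ho =>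
  mem_outcomesOf.2 ⟨h (mem_outcomesOf.1 ho).1, (mem_outcomesOf.1 ho).2⟩

theorem xval_outcomesOf {E : Type*} (F : Finset E) (ω : Realization E) :
    xval (outcomesOf F ω) = ∑ e ∈ F, (ω e).1 := by
  classical
  unfold xval outcomesOf
  rw [Finset.sum_image]
  intro a _ b _ h
  exact congrArg Prod.fst h

/-- The sets of outcomes that lie in the sets `B e` and whose elements form a member of `F`. -/
def acceptableSets {E : Type*} (I : ProbingInstance E) (B : E → Set (ℝ≥0 × ℝ≥0)) (F : Set (Finset E)) :
    Set (Finset (Outcome E)) :=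
  {T | T ∈ I.OmegaIn ∧ (∀ o ∈ T, o.2 ∈ B o.1) ∧ elements T ∈ F}

theorem outcomesOf_mem_acceptableSets {E : Type*} {I : ProbingInstance E} {B : E → Set (ℝ≥0 × ℝ≥0)}
    {F : Set (Finset E)} (hF : ∀ T ∈ F, I.inner.feasible T) {G : Finset E} {ω : Realization E} :
    outcomesOf G ω ∈ acceptableSets I B F ↔
      (∀ e ∈ G, ω e ∈ (I.μ e).support) ∧ (∀ e ∈ G, ω e ∈ B e) ∧ G ∈ F := by
  have h (P : E → ℝ≥0 × ℝ≥0 → Prop) :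
      (∀ o ∈ outcomesOf G ω, P o.1 o.2) ↔ ∀ e ∈ G, P e (ω e) := by
    constructor
    · intro h e he
      exact h (e, ω e) (mem_outcomesOf.2 ⟨he, rfl⟩)
    · intro h o ho
      rw [mem_outcomesOf] at ho
      rw [ho.2]
      exact h _ ho.1
  simp only [acceptableSets, ProbingInstance.OmegaIn, Set.mem_ofPred_eq, elements_outcomesOf]
  rw [h fun e z => z ∈ (I.μ e).support, h fun e z => z ∈ B e]
  exact ⟨fun ⟨⟨h1, _, _⟩, h2, h3⟩ => ⟨h1, h2, h3⟩,
    fun ⟨h1, h2, h3⟩ => ⟨⟨h1, injOn_fst_outcomesOf G ω, hF G h3⟩, h2, h3⟩⟩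

theorem isPolicy_acceptableSets {E : Type*} {I : ProbingInstance E} {B : E → Set (ℝ≥0 × ℝ≥0)}
    {F : Set (Finset E)} (hB : ∀ e, MeasurableSet (B e)) (hF : ∀ T ∈ F, I.inner.feasible T) :
    I.IsPolicy (acceptableSets I B F) := by
  refine ⟨fun T hT => hT.1, fun G => ?_⟩
  simp only [outcomesOf_mem_acceptableSets hF, Set.ofPred_and, Set.ofPred_forall]
  refine MeasurableSet.inter ?_ (MeasurableSet.inter ?_ (MeasurableSet.const _))
  · exact MeasurableSet.biInter G.countable_toSet fun e _ =>
      (measurable_pi_apply e) Measure.isClosed_support.measurableSet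
  · exact MeasurableSet.biInter G.countable_toSet fun e _ => (measurable_pi_apply e) (hB e)

variable {E : Type*} [Fintype E]

theorem result_mem_acceptableSets {I : ProbingInstance E} {B : E → Set (ℝ≥0 × ℝ≥0)}
    {F : Set (Finset E)} (h0 : ∅ ∈ F) (hF : ∀ T ∈ F, I.inner.feasible T) (s : AgentStrategy E)
    (ω : Realization E) :
    s.result (acceptableSets I B F) ω ∈ acceptableSets I B F ∧
      s.result (acceptableSets I B F) ω ⊆ outcomesOf Finset.univ ω := by
  unfold AgentStrategy.result
  dsimp only
  split_ifs with h
  · exact ⟨h.1, h.2.trans (outcomesOf_mono (Finset.subset_univ _) ω)⟩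
  · refine ⟨?_, Finset.empty_subset _⟩
    have : outcomesOf ∅ ω ∈ acceptableSets I B F :=
      (outcomesOf_mem_acceptableSets hF).2 ⟨by simp, by simp, h0⟩
    simpa [outcomesOf] using this

/-- A set of realized outcomes that is maximal among the acceptable ones contains every active
selectable element. -/
theorem mem_elements_of_selectable {I : ProbingInstance E} {B : E → Set (ℝ≥0 × ℝ≥0)}
    {F : Set (Finset E)} (hF : ∀ T ∈ F, I.inner.feasible T) {ω : Realization E}
    (hsupp : ∀ e, ω e ∈ (I.μ e).support) {S : Finset (Outcome E)}
    (hS : S ∈ acceptableSets I B F) (hSω : S ⊆ outcomesOf Finset.univ ω)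
    (hmax : ∀ T ∈ acceptableSets I B F, T ⊆ outcomesOf Finset.univ ω → ¬ S ⊂ T)
    {A : Finset E} (hA : ∀ e, e ∈ A ↔ ω e ∈ B e) {e : E} (he : e ∈ A)
    (hsel : Selectable F e A) : e ∈ elements S := by
  classical
  by_contra hne
  have hSeq := eq_outcomesOf_elements hSω
  generalize elements S = G at hSeq hne
  subst hSeq
  rw [outcomesOf_mem_acceptableSets hF] at hS
  -- If e were missing, selectability would make the solution enlarged by e acceptable, against
  -- maximality.
  have hacc : outcomesOf (insert e G) ω ∈ acceptableSets I B F := by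
    refine (outcomesOf_mem_acceptableSets hF).2 ⟨fun f _ => hsupp f, fun f hf => ?_,
      by convert hsel G hS.2.2 fun f hf => (hA f).2 (hS.2.1 f hf)⟩
    rcases Finset.mem_insert.1 hf with rfl | hf
    · exact (hA f).1 he
    · exact hS.2.1 f hf
  refine hmax _ hacc (outcomesOf_mono (Finset.subset_univ _) ω)
    ⟨outcomesOf_mono (Finset.subset_insert _ _) ω, fun hsub => hne ?_⟩
  exact (mem_outcomesOf.1 (hsub ((mem_outcomesOf (o := (e, ω e))).2
    ⟨Finset.mem_insert_self _ _, rfl⟩))).1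

open Classical in
/-- Against a thorough agent, the principal obtains every active selectable element. -/
theorem lintegral_selectable_le_principalValue {I : ProbingInstance E}
    (hout : I.outer = trivialSystem E) {B : E → Set (ℝ≥0 × ℝ≥0)} {F : Set (Finset E)}
    (h0 : ∅ ∈ F) (hF : ∀ T ∈ F, I.inner.feasible T) {s : AgentStrategy E}
    (hs : I.IsThorough (acceptableSets I B F) s) :
    ∫⁻ ω, ∑ e ∈ ({e | ω e ∈ B e} : Finset E) with Selectable F e ({e | ω e ∈ B e} : Finset E),
        ((ω e).1 : ℝ≥0∞) ∂I.law ≤ I.principalValue (acceptableSets I B F) s := by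
  have := I.isProb
  -- Acceptable sets may only use outcomes in the supports; almost every realization satisfies this.
  have hsupp : ∀ᵐ ω ∂I.law, ∀ e, ω e ∈ (I.μ e).support := by
    rw [ae_all_iff]
    exact fun e => (measurePreserving_eval I.μ e).quasiMeasurePreserving.ae
      Measure.support_mem_ae
  refine lintegral_mono_ae ?_
  filter_upwards [hs, hsupp] with ω hω hsupp
  obtain ⟨hres, hsub⟩ := result_mem_acceptableSets (B := B) h0 hF s ω
  have hval : xval (s.result (acceptableSets I B F) ω) =
      ∑ e ∈ elements (s.result (acceptableSets I B F) ω), (ω e).1 := by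
    conv_lhs => rw [eq_outcomesOf_elements hsub]
    exact xval_outcomesOf _ ω
  rw [hval, ENNReal.ofNNReal_finsetSum]
  refine Finset.sum_le_sum_of_subset fun e he => ?_
  rw [Finset.mem_filter] at he
  exact mem_elements_of_selectable hF hsupp hres hsub
    (fun T hT hTω => hω T hT hTω (by rw [hout]; exact True.intro)) (by simp) he.1 he.2

open Classical in
/-- The probability that `e` belongs to a random set with law `lam`. -/
noncomputable def coverProb (lam : Finset E → ℝ) (e : E) : ℝ := ∑ G with e ∈ G, lam G

/-- A contention resolution condition that suffices for the existence of an `α`-policy. -/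
theorem exists_isAlphaPolicy (I : ProbingInstance E) (hout : I.outer = trivialSystem E) {α : ℝ}
    (h : ∀ (lam : Finset E → ℝ) (v : E → ℝ≥0∞), (∀ G, 0 ≤ lam G) →
      (∀ G, ¬ I.inner.feasible G → lam G = 0) → ∑ G, lam G = 1 →
      (∀ e, coverProb lam e = 0 → v e = 0) →
      ∃ (r : E → ℝ) (F : Set (Finset E)), (∀ e, 0 ≤ r e) ∧ (∀ e, r e ≤ 1) ∧ ∅ ∈ F ∧
        (∀ T ∈ F, I.inner.feasible T) ∧
        ENNReal.ofReal α * ∑ e, v e ≤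
          ∑ e, v e * ENNReal.ofReal (r e * selectProb (fun f => r f * coverProb lam f) F e)) :
    ∃ R, I.IsAlphaPolicy α R := by
  classical
  have := I.isProb
  have : IsProbabilityMeasure I.law := by unfold ProbingInstance.law; infer_instance
  have hcoord (e : E) : Measurable fun ω : Realization E => (ω e).1 :=
    measurable_fst.comp (measurable_pi_apply e)
  -- `g ω` is an optimal feasible set for an omniscient principal, chosen measurably.
  obtain ⟨g, hg, hgs, hgmax⟩ := exists_measurable_argmax
    (s := Finset.univ.filter I.inner.feasible) ⟨∅, by simp [I.inner.empty_feasible]⟩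
    (f := fun G (ω : Realization E) => ∑ e ∈ G, (ω e).1)
    fun G => Finset.measurable_sum _ fun e _ => hcoord e
  have hmem (e : E) : MeasurableSet {ω | e ∈ g ω} := by
    have : {ω | e ∈ g ω} = ⋃ G ∈ Finset.univ.filter (fun G : Finset E => e ∈ G),
        {ω | g ω = G} := by
      ext ω
      simp
    rw [this]
    exact Finset.measurableSet_biUnion _ fun G _ => hg G
  let χ (e : E) (ω : Realization E) : ℝ≥0∞ := {ω | e ∈ g ω}.indicator (fun _ => 1) ω
  have hχ (e : E) : Measurable (χ e) := measurable_const.indicator (hmem e)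
  -- The conditional probability that e belongs to the optimum, given that it realizes z.
  let Q (e : E) (z : ℝ≥0 × ℝ≥0) : ℝ≥0∞ := ∫⁻ ω, χ e (Function.update ω e z) ∂I.law
  have hQ (e : E) : Measurable (Q e) := by
    have hm : Measurable fun x : (ℝ≥0 × ℝ≥0) × Realization E =>
        χ e (Function.update x.2 e x.1) :=
      (hχ e).comp (measurable_update'.comp measurable_swap)
    exact hm.lintegral_prod_right'
  have hQ1 (e : E) (z : ℝ≥0 × ℝ≥0) : Q e z ≤ 1 := by
    calc Q e z ≤ ∫⁻ _, 1 ∂I.law := lintegral_mono fun ω => Set.indicator_le_self' (by simp) _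
      _ = 1 := by simp
  let lam (G : Finset E) : ℝ := (I.law {ω | g ω = G}).toReal
  let v (e : E) : ℝ≥0∞ := ∫⁻ z, Q e z * z.1 ∂I.μ e
  have hcover (e : E) : ∫⁻ z, Q e z ∂I.μ e = ENNReal.ofReal (coverProb lam e) := by
    have h1 : ∫⁻ z, Q e z ∂I.μ e = I.law {ω | e ∈ g ω} := by
      rw [← lintegral_indicator_one (hmem e)]
      exact (lintegral_pi_eq_lintegral_update e (hχ e)).symm
    have h2 : {ω | e ∈ g ω} = ⋃ G ∈ Finset.univ.filter (fun G : Finset E => e ∈ G),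
        {ω | g ω = G} := by
      ext ω
      simp
    rw [h1, h2, measure_biUnion_finset _ fun G _ => hg G, coverProb,
      ENNReal.ofReal_sum_of_nonneg fun G _ => ENNReal.toReal_nonneg]
    · exact Finset.sum_congr rfl fun G _ => (ENNReal.ofReal_toReal (measure_ne_top _ _)).symm
    · intro G _ G' _ hne
      exact Set.disjoint_left.2 fun ω h1 h2 => hne (h1.symm.trans h2)
  have hsum : ∑ G, lam G = 1 := by
    have h1 : I.law (⋃ G ∈ (Finset.univ : Finset (Finset E)), {ω | g ω = G}) =
        ∑ G, I.law {ω | g ω = G} := by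
      refine measure_biUnion_finset ?_ fun G _ => hg G
      intro G _ G' _ hne
      exact Set.disjoint_left.2 fun ω h1 h2 => hne (h1.symm.trans h2)
    have h2 : (⋃ G ∈ (Finset.univ : Finset (Finset E)), {ω | g ω = G}) = Set.univ := by
      ext ω
      simp
    rw [h2, measure_univ] at h1
    rw [← ENNReal.toReal_sum fun G _ => measure_ne_top _ _, ← h1, ENNReal.toReal_one]
  obtain ⟨r, F, hr0, hr1, hF0, hF, hineq⟩ := h lam v (fun G => ENNReal.toReal_nonneg)
    (fun G hG => by
      have : {ω | g ω = G} = ∅ := by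
        ext ω
        simp only [Set.mem_ofPred_eq, Set.mem_empty_iff_false, iff_false]
        rintro rfl
        exact hG (by simpa using hgs ω)
      simp [lam, this]) hsum
    (fun e he => by
      have h0 : ∫⁻ z, Q e z ∂I.μ e = 0 := by rw [hcover, he, ENNReal.ofReal_zero]
      rw [lintegral_eq_zero_iff (hQ e)] at h0
      refine (lintegral_congr_ae ?_).trans lintegral_zero
      filter_upwards [h0] with z hz
      simp [hz])
  -- Any feasible set of probed elements competes in the maximum that defines `g ω`.
  have hopt : I.nonDelegatedValue ≤ ∑ e, v e := by
    refine iSup₂_le fun a _ => ?_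
    have h1 (ω : Realization E) :
        (I.u (a.probed ω) ω : ℝ≥0∞) ≤ ∑ e, χ e ω * ((ω e).1 : ℝ≥0∞) := by
      have : I.u (a.probed ω) ω ≤ ∑ e ∈ g ω, (ω e).1 := by
        refine Finset.sup_le fun G hG => hgmax ω G ?_
        simpa using (Finset.mem_filter.1 hG).2
      refine (ENNReal.coe_le_coe.2 this).trans_eq ?_
      rw [ENNReal.ofNNReal_finsetSum, ← Finset.sum_filter_add_sum_filter_not Finset.univ
        (fun e => e ∈ g ω) fun e => χ e ω * ((ω e).1 : ℝ≥0∞)]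
      rw [Finset.sum_eq_zero (s := Finset.univ.filter fun e => e ∉ g ω), add_zero,
        Finset.filter_mem_eq_inter, Finset.univ_inter]
      · refine Finset.sum_congr rfl fun e he => ?_
        simp [χ, he]
      · intro e he
        have : e ∉ g ω := by simpa using he
        simp [χ, this]
    refine (lintegral_mono h1).trans_eq ?_
    have hm (e : E) : Measurable fun ω : Realization E => χ e ω * ((ω e).1 : ℝ≥0∞) :=
      (hχ e).mul (hcoord e).coe_nnreal_ennreal
    rw [lintegral_finsetSum _ fun e _ => hm e]
    refine Finset.sum_congr rfl fun e _ => ?_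
    refine (lintegral_pi_eq_lintegral_update e (hm e)).trans (lintegral_congr fun z => ?_)
    simp only [Function.update_self]
    exact lintegral_mul_const _ ((hχ e).comp measurable_update_left)
  let q (e : E) (z : ℝ≥0 × ℝ≥0) : ℝ≥0∞ := ENNReal.ofReal (r e) * Q e z
  have hq (e : E) : Measurable (q e) := (hQ e).const_mul _
  have hq1 (e : E) (z : ℝ≥0 × ℝ≥0) : q e z ≤ 1 :=
    mul_le_one' (ENNReal.ofReal_le_one.2 (hr1 e)) (hQ1 e z)
  have hx (e : E) : Measurable fun z : ℝ≥0 × ℝ≥0 => (z.1 : ℝ≥0∞) :=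
    measurable_fst.coe_nnreal_ennreal
  have hval := lintegral_sum_subsetWeight_mul_sum (μ := I.μ) hq hq1 hx
    (σ := fun e A => Selectable F e A) fun e A => selectable_insert
  obtain ⟨B, hB, hle⟩ := exists_measurableSet_le_lintegral (μ := I.μ) hq hq1
    (H := fun ω A => ∑ e ∈ A with Selectable F e A, ((ω e).1 : ℝ≥0∞))
    fun A => Finset.measurable_sum _ fun e _ => (hcoord e).coe_nnreal_ennreal
  have hcov0 (e : E) : 0 ≤ coverProb lam e :=
    Finset.sum_nonneg fun G _ => ENNReal.toReal_nonneg
  have hcov1 (e : E) : coverProb lam e ≤ 1 :=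
    hsum ▸ Finset.sum_le_sum_of_subset_of_nonneg (Finset.filter_subset _ _)
      fun G _ _ => ENNReal.toReal_nonneg
  have hp0 (e : E) : 0 ≤ r e * coverProb lam e := mul_nonneg (hr0 e) (hcov0 e)
  have hp1 (e : E) : r e * coverProb lam e ≤ 1 := mul_le_one₀ (hr1 e) (hcov0 e) (hcov1 e)
  refine ⟨acceptableSets I B F, isPolicy_acceptableSets hB hF, fun s _ hs => ?_⟩
  calc ENNReal.ofReal α * I.nonDelegatedValue
      ≤ ENNReal.ofReal α * ∑ e, v e := by gcongr
    _ ≤ _ := hineq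
    _ = ∑ e, (∫⁻ z, q e z * z.1 ∂I.μ e) *
        ∑ A with Selectable F e A, subsetWeight (fun e => ∫⁻ z, q e z ∂I.μ e) A := by
      refine Finset.sum_congr rfl fun e _ => ?_
      have h1 (f : E) : ∫⁻ z, q f z ∂I.μ f = ENNReal.ofReal (r f * coverProb lam f) := by
        rw [lintegral_const_mul _ (hQ f), hcover, ENNReal.ofReal_mul (hr0 f)]
      have h2 : ∫⁻ z, q e z * z.1 ∂I.μ e = ENNReal.ofReal (r e) * v e := by
        simp only [q, mul_assoc]
        exact lintegral_const_mul _ ((hQ e).mul (hx e))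
      simp only [h1, h2]
      rw [ENNReal.ofReal_mul (hr0 e), selectProb,
        ENNReal.ofReal_sum_of_nonneg fun A _ => subsetWeight_nonneg hp0 hp1 A]
      simp only [ofReal_subsetWeight hp0 hp1]
      ring
    _ = _ := hval.symm
    _ ≤ _ := hle
    _ ≤ _ := lintegral_selectable_le_principalValue hout hF0 hF hs

end Policy

/-! ### Covering probabilities and packing inequalities -/

section Cover

variable {E : Type*} [Fintype E]

theorem coverProb_nonneg {lam : Finset E → ℝ} (h0 : ∀ G, 0 ≤ lam G) (e : E) :
    0 ≤ coverProb lam e := by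
  classical
  exact Finset.sum_nonneg fun G _ => h0 G

theorem coverProb_le_one {lam : Finset E → ℝ} (h0 : ∀ G, 0 ≤ lam G) (h1 : ∑ G, lam G = 1)
    (e : E) : coverProb lam e ≤ 1 := by
  classical
  exact h1 ▸ Finset.sum_le_sum_of_subset_of_nonneg (Finset.filter_subset _ _) fun G _ _ => h0 G

theorem feasible_of_coverProb_pos {M : SetSystem E} {lam : Finset E → ℝ}
    (hM : ∀ G, ¬ M.feasible G → lam G = 0) {e : E} (he : 0 < coverProb lam e) :
    M.feasible {e} := by
  classical
  by_contra h
  refine he.ne' (Finset.sum_eq_zero fun G hG => hM G fun hG' => h ?_)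
  exact M.down_closed (Finset.singleton_subset_iff.2 (Finset.mem_filter.1 hG).2) hG'

open Classical in
/-- The vector of covering probabilities satisfies every packing inequality that is valid for the
feasible sets. -/
theorem sum_coverProb_mul_le {M : SetSystem E} {lam : Finset E → ℝ} (h0 : ∀ G, 0 ≤ lam G)
    (hM : ∀ G, ¬ M.feasible G → lam G = 0) (h1 : ∑ G, lam G = 1) {w : E → ℝ} {D : Finset E}
    {c : ℝ} (hc : ∀ G, M.feasible G → ∑ e ∈ D with e ∈ G, w e ≤ c) :
    ∑ e ∈ D, coverProb lam e * w e ≤ c := by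
  have h : ∑ e ∈ D, coverProb lam e * w e = ∑ G, lam G * ∑ e ∈ D with e ∈ G, w e := by
    simp_rw [coverProb, Finset.sum_mul, Finset.mul_sum]
    exact Finset.sum_comm' (by simp)
  rw [h]
  calc ∑ G, lam G * ∑ e ∈ D with e ∈ G, w e ≤ ∑ G, lam G * c := by
        refine Finset.sum_le_sum fun G _ => ?_
        by_cases hG : M.feasible G
        · exact mul_le_mul_of_nonneg_left (hc G hG) (h0 G)
        · simp [hM G hG]
    _ = c := by rw [← Finset.sum_mul, h1, one_mul]

/-- The product is the probability that no element of `D` is active. -/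
theorem prod_one_sub_le_selectProb {p : E → ℝ} (h0 : ∀ e, 0 ≤ p e) (h1 : ∀ e, p e ≤ 1)
    {F : Set (Finset E)} {e : E} {D : Finset E} (h : ∀ A, Disjoint A D → Selectable F e A) :
    ∏ f ∈ D, (1 - p f) ≤ selectProb p F e := by
  classical
  rw [← sum_subsetWeight_disjoint, selectProb]
  exact Finset.sum_le_sum_of_subset_of_nonneg
    (Finset.monotone_filter_right _ fun A _ hA => h A hA)
    fun A _ _ => subsetWeight_nonneg h0 h1 A

/-- A guarantee for each element separately needs no knowledge of the values `v`; elements of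
covering probability zero carry no value. -/
theorem exists_isAlphaPolicy_of_forall_le (I : ProbingInstance E)
    (hout : I.outer = trivialSystem E) {α : ℝ}
    (h : ∀ lam : Finset E → ℝ, (∀ G, 0 ≤ lam G) →
      (∀ G, ¬ I.inner.feasible G → lam G = 0) → ∑ G, lam G = 1 →
      ∃ (r : E → ℝ) (F : Set (Finset E)), (∀ e, 0 ≤ r e) ∧ (∀ e, r e ≤ 1) ∧ ∅ ∈ F ∧
        (∀ T ∈ F, I.inner.feasible T) ∧ ∀ e, 0 < coverProb lam e →
          α ≤ r e * selectProb (fun f => r f * coverProb lam f) F e) :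
    ∃ R, I.IsAlphaPolicy α R := by
  refine exists_isAlphaPolicy I hout fun lam v h0 hM h1 hv => ?_
  obtain ⟨r, F, hr0, hr1, hF0, hF, hα⟩ := h lam h0 hM h1
  refine ⟨r, F, hr0, hr1, hF0, hF, ?_⟩
  rw [Finset.mul_sum]
  refine Finset.sum_le_sum fun e _ => ?_
  rcases (coverProb_nonneg h0 e).eq_or_lt with he | he
  · simp [hv e he.symm]
  · rw [mul_comm]
    gcongr
    exact hα e he

end Cover

/-! ### Matching constraints -/

section Matching

/-- With t = p/2 the right side is exp(t)(exp(t) − 1), where exp(t) ≥ 1 and exp(t) − 1 ≥ t. -/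
theorem half_le_one_sub_exp_mul_exp {p : ℝ} (hp : 0 ≤ p) :
    p / 2 ≤ (1 - Real.exp (-(p / 2))) * Real.exp p := by
  have h1 := Real.add_one_le_exp (p / 2)
  have h2 : (1 - Real.exp (-(p / 2))) * Real.exp p =
      Real.exp (p / 2) * (Real.exp (p / 2) - 1) := by
    have h3 : Real.exp p = Real.exp (p / 2) * Real.exp (p / 2) := by
      rw [← Real.exp_add]
      ring_nf
    have h4 : Real.exp (-(p / 2)) * Real.exp (p / 2) = 1 := by
      rw [← Real.exp_add]
      simp
    rw [h3]
    linear_combination -Real.exp (p / 2) * h4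
  rw [h2]
  nlinarith

/-- The attenuation makes e inactive with probability exactly exp(−p_e/2), so the product over
neighbouring edges becomes the exponential of a sum. The edges at each end point of e other than e
have total p at most 1 − p_e, so e is free with probability at least exp(−(1 − p_e)). -/
theorem exists_isAlphaPolicy_matching {E V : Type*} [Fintype E] (I : ProbingInstance E)
    (hout : I.outer = trivialSystem E) (ends : E → Sym2 V)
    (hin : I.inner = matchingSystem ends) :
    ∃ R, I.IsAlphaPolicy (1 / (2 * Real.exp 1)) R := by
  classical
  refine exists_isAlphaPolicy_of_forall_le I hout fun lam h0 hM h1 => ?_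
  have hp0 := coverProb_nonneg h0
  have hp1 := coverProb_le_one h0 h1
  set p := coverProb lam with hp
  -- For p e = 0 the quotient is 0 by convention, and both sides vanish.
  have hrp (e : E) : (1 - Real.exp (-(p e / 2))) / p e * p e = 1 - Real.exp (-(p e / 2)) := by
    rcases (hp0 e).eq_or_lt with he | he
    · simp [← he]
    · exact div_mul_cancel₀ _ he.ne'
  have hexp (e : E) : Real.exp (-(p e / 2)) ≤ 1 :=
    Real.exp_le_one_iff.2 (by linarith [hp0 e])
  refine ⟨fun e => (1 - Real.exp (-(p e / 2))) / p e, {T | I.inner.feasible T},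
    fun e => div_nonneg (by linarith [hexp e]) (hp0 e), fun e => ?_, I.inner.empty_feasible,
    fun T hT => hT, fun e he => ?_⟩
  · refine div_le_one_of_le₀ ?_ (hp0 e)
    linarith [Real.add_one_le_exp (-(p e / 2)), hp0 e]
  simp only [hrp]
  have hloop : ¬ (ends e).IsDiag := by
    have := feasible_of_coverProb_pos hM he
    rw [hin] at this
    exact this.1 e (Finset.mem_singleton_self e)
  let N (w : V) : Finset E := {f | f ≠ e ∧ w ∈ ends f}
  -- A matching contains at most one edge at w, counting e itself.
  have hN (w : V) (hw : w ∈ ends e) : ∑ f ∈ N w, p f ≤ 1 - p e := by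
    have := sum_coverProb_mul_le (w := fun _ => 1) (D := insert e (N w)) (c := 1) h0 hM h1
      fun G hG => by
        rw [hin] at hG
        rw [Finset.sum_const, nsmul_one, ← Nat.cast_one, Nat.cast_le, Finset.card_le_one]
        have hmem : ∀ a ∈ (insert e (N w)).filter (· ∈ G), a ∈ G ∧ w ∈ ends a := by
          intro a ha
          rw [Finset.mem_filter, Finset.mem_insert] at ha
          rcases ha.1 with rfl | ha'
          · exact ⟨ha.2, hw⟩
          · exact ⟨ha.2, (Finset.mem_filter.1 ha').2.2⟩
        intro a ha b hb
        by_contra hab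
        exact hG.2 a (hmem a ha).1 b (hmem b hb).1 hab w (hmem a ha).2 (hmem b hb).2
    rw [Finset.sum_insert (by simp [N])] at this
    simp only [mul_one] at this
    linarith
  obtain ⟨u, w, huw⟩ : ∃ u w, ends e = s(u, w) := by
    induction h : ends e with
    | h u w => exact ⟨u, w, rfl⟩
  have hsum : ∑ f ∈ N u ∪ N w, p f ≤ 2 * (1 - p e) := by
    have h2 := Finset.sum_union_inter (s₁ := N u) (s₂ := N w) (f := p)
    have h3 : 0 ≤ ∑ f ∈ N u ∩ N w, p f := Finset.sum_nonneg fun f _ => hp0 f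
    linarith [hN u (by simp [huw]), hN w (by simp [huw])]
  have hsel : Real.exp (-(1 - p e)) ≤
      selectProb (fun f => 1 - Real.exp (-(p f / 2))) {T | I.inner.feasible T} e := by
    refine le_trans ?_ (prod_one_sub_le_selectProb (D := N u ∪ N w)
      (fun f => by linarith [hexp f]) (fun f => by linarith [Real.exp_pos (-(p f / 2))])
      fun A hA T hT hTA => ?_)
    · simp only [sub_sub_cancel]
      rw [← Real.exp_sum, Real.exp_le_exp, Finset.sum_neg_distrib, ← Finset.sum_div]
      linarith
    · rw [Set.mem_ofPred_eq, hin] at hT ⊢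
      have hdisj : ∀ f ∈ T, f ≠ e → ∀ x, x ∈ ends e → x ∉ ends f := by
        intro f hf hfe x hx hxf
        refine Finset.disjoint_left.1 hA (hTA hf) ?_
        rw [huw, Sym2.mem_iff] at hx
        rw [Finset.mem_union]
        rcases hx with rfl | rfl
        · exact Or.inl (by simp [N, hfe, hxf])
        · exact Or.inr (by simp [N, hfe, hxf])
      refine ⟨fun f hf => ?_, fun f hf g hg hfg x hx hxg => ?_⟩
      · rcases Finset.mem_insert.1 hf with rfl | hf
        · exact hloop
        · exact hT.1 f hf
      · by_cases hfe : f = e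
        · subst hfe
          exact hdisj g ((Finset.mem_insert.1 hg).resolve_left hfg.symm) hfg.symm x hx hxg
        · have hf' := (Finset.mem_insert.1 hf).resolve_left hfe
          by_cases hge : g = e
          · subst hge
            exact hdisj f hf' hfe x hxg hx
          · exact hT.2 f hf' g ((Finset.mem_insert.1 hg).resolve_left hge) hfg x hx hxg
  calc 1 / (2 * Real.exp 1) = (p e / 2) / p e * Real.exp (-1) := by
        rw [Real.exp_neg]
        field_simp
    _ ≤ (1 - Real.exp (-(p e / 2))) * Real.exp (p e) / p e * Real.exp (-1) := by
        gcongr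
        exact half_le_one_sub_exp_mul_exp (hp0 e)
    _ = (1 - Real.exp (-(p e / 2))) / p e * Real.exp (-(1 - p e)) := by
        rw [show -(1 - p e) = p e + -1 by ring, Real.exp_add]
        ring
    _ ≤ _ := mul_le_mul_of_nonneg_left hsel
        (div_nonneg (by linarith [hexp e]) (hp0 e))

end Matching

/-! ### Knapsack constraints -/

section Knapsack

variable {E : Type*} [Fintype E]

theorem selectProb_eq_one {p : E → ℝ} {F : Set (Finset E)} {e : E}
    (h : ∀ A, Selectable F e A) : selectProb p F e = 1 := by
  classical
  rw [selectProb, Finset.filter_true_of_mem fun A _ => h A, sum_subsetWeight]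

open Classical in
/-- Markov's inequality for the probability that `e` is not selectable. -/
theorem mul_one_sub_selectProb_le {p : E → ℝ} (h0 : ∀ e, 0 ≤ p e) (h1 : ∀ e, p e ≤ 1)
    {F : Set (Finset E)} {e : E} {w : E → ℝ} (hw : ∀ e, 0 ≤ w e) {D : Finset E} {t : ℝ}
    (h : ∀ A, ¬ Selectable F e A → t ≤ ∑ f ∈ A ∩ D, w f) :
    t * (1 - selectProb p F e) ≤ ∑ f ∈ D, p f * w f := by
  have hsplit := Finset.sum_filter_add_sum_filter_not (s := Finset.univ)
    (fun A => Selectable F e A) (subsetWeight p)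
  rw [sum_subsetWeight] at hsplit
  rw [selectProb, ← hsplit, add_sub_cancel_left, ← sum_subsetWeight_mul_sum, Finset.mul_sum]
  calc ∑ A with ¬ Selectable F e A, t * subsetWeight p A
      ≤ ∑ A with ¬ Selectable F e A, subsetWeight p A * ∑ f ∈ A ∩ D, w f := by
        refine Finset.sum_le_sum fun A hA => ?_
        rw [mul_comm]
        exact mul_le_mul_of_nonneg_left (h A (Finset.mem_filter.1 hA).2)
          (subsetWeight_nonneg h0 h1 A)
    _ ≤ _ := Finset.sum_le_sum_of_subset_of_nonneg (Finset.filter_subset _ _) fun A _ _ =>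
        mul_nonneg (subsetWeight_nonneg h0 h1 A) (Finset.sum_nonneg fun f _ => hw f)

/-- If each of two families handles one part of the elements, then the better one of the two is at
least as good as a random choice between them. -/
theorem exists_family_of_two {p : E → ℝ} {v : E → ℝ≥0∞} {b α π : ℝ} {D : Finset E}
    {F₁ F₂ : Set (Finset E)} {s₁ s₂ : ℝ} (hπ0 : 0 ≤ π) (hπ1 : π ≤ 1) (hb : 0 ≤ b)
    (h₁ : α ≤ π * (b * s₁)) (h₂ : α ≤ (1 - π) * (b * s₂))
    (hF₁ : ∀ e ∈ D, v e ≠ 0 → s₁ ≤ selectProb p F₁ e)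
    (hF₂ : ∀ e ∉ D, v e ≠ 0 → s₂ ≤ selectProb p F₂ e) :
    ∃ F, (F = F₁ ∨ F = F₂) ∧ ENNReal.ofReal α * ∑ e, v e ≤
      ∑ e, v e * ENNReal.ofReal (b * selectProb p F e) := by
  classical
  have hle (D' : Finset E) (F : Set (Finset E)) (s : ℝ)
      (hs : ∀ e ∈ D', v e ≠ 0 → s ≤ selectProb p F e) :
      (∑ e ∈ D', v e) * ENNReal.ofReal (b * s) ≤
        ∑ e, v e * ENNReal.ofReal (b * selectProb p F e) := by
    rw [Finset.sum_mul]
    refine le_trans (Finset.sum_le_sum fun e he => ?_)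
      (Finset.sum_le_sum_of_subset (Finset.subset_univ D'))
    by_cases hv : v e = 0
    · simp [hv]
    · have := hs e he hv
      gcongr
  have hX := hle D F₁ s₁ hF₁
  have hY := hle Dᶜ F₂ s₂ fun e he => hF₂ e (Finset.mem_compl.1 he)
  set X := (∑ e ∈ D, v e) * ENNReal.ofReal (b * s₁)
  set Y := (∑ e ∈ Dᶜ, v e) * ENNReal.ofReal (b * s₂)
  have hsum : ENNReal.ofReal α * ∑ e, v e ≤
      ENNReal.ofReal π * X + ENNReal.ofReal (1 - π) * Y := by
    rw [← Finset.sum_add_sum_compl D, mul_add]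
    gcongr ?_ + ?_
    · calc _ ≤ ENNReal.ofReal (π * (b * s₁)) * ∑ e ∈ D, v e := by gcongr
        _ = _ := by
          rw [ENNReal.ofReal_mul hπ0]
          ring
    · calc _ ≤ ENNReal.ofReal ((1 - π) * (b * s₂)) * ∑ e ∈ Dᶜ, v e := by gcongr
        _ = _ := by
          rw [ENNReal.ofReal_mul (sub_nonneg.2 hπ1)]
          ring
  have hone : ENNReal.ofReal π + ENNReal.ofReal (1 - π) = 1 := by
    rw [← ENNReal.ofReal_add hπ0 (sub_nonneg.2 hπ1)]
    simp
  rcases le_total X Y with hXY | hXY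
  · refine ⟨F₂, Or.inr rfl, hsum.trans (le_trans ?_ hY)⟩
    calc _ ≤ ENNReal.ofReal π * Y + ENNReal.ofReal (1 - π) * Y := by gcongr
      _ = Y := by rw [← add_mul, hone, one_mul]
  · refine ⟨F₁, Or.inl rfl, hsum.trans (le_trans ?_ hX)⟩
    calc _ ≤ ENNReal.ofReal π * X + ENNReal.ofReal (1 - π) * X := by gcongr
      _ = X := by rw [← add_mul, hone, one_mul]

/-- The acceptable sets that consist of at most one element, which is more than half as large as
the capacity. -/
def bigFamily (size : E → ℝ≥0) (cap : ℝ≥0) : Set (Finset E) :=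
  {T | T = ∅ ∨ ∃ e, cap < 2 * size e ∧ size e ≤ cap ∧ T = {e}}

/-- The acceptable sets that consist of elements that are at most half as large as the capacity. -/
def smallFamily (size : E → ℝ≥0) (cap : ℝ≥0) : Set (Finset E) :=
  {T | (∀ e ∈ T, 2 * size e ≤ cap) ∧ ∑ e ∈ T, size e ≤ cap}

/-- A big item can be blocked only by an active big item, and the expected number of these bounds
the probability that one exists. -/
theorem one_sub_le_selectProb_bigFamily {p : E → ℝ} (h0 : ∀ e, 0 ≤ p e) (h1 : ∀ e, p e ≤ 1)
    {size : E → ℝ≥0} {cap : ℝ≥0} {e : E} (he : cap < 2 * size e) (he' : size e ≤ cap) :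
    1 - ∑ f with cap < 2 * size f, p f ≤ selectProb p (bigFamily size cap) e := by
  classical
  have h := mul_one_sub_selectProb_le (F := bigFamily size cap) (e := e) (t := 1)
    (D := ({f | cap < 2 * size f} : Finset E)) h0 h1 (w := fun _ => 1) (fun _ => zero_le_one)
    fun A hA => by
      rw [Selectable] at hA
      push Not at hA
      obtain ⟨I, hI, hIA, hne⟩ := hA
      rcases hI with rfl | ⟨f, hf, hf', rfl⟩
      · exact absurd (Or.inr ⟨e, he, he', by simp⟩) hne
      · have hmem : f ∈ A ∩ ({f | cap < 2 * size f} : Finset E) := by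
          simpa [hf] using hIA
        have : 1 ≤ (A ∩ ({f | cap < 2 * size f} : Finset E)).card :=
          Finset.card_pos.2 ⟨f, hmem⟩
        simpa using this
  simp only [mul_one, one_mul] at h
  linarith

/-- If a small item does not fit, the active small items already exceed half the capacity; Markov's
inequality bounds this event. At capacity zero the quotient is 0 and all small items have size 0, so
nothing is ever blocked. -/
theorem one_sub_le_selectProb_smallFamily {p : E → ℝ} (h0 : ∀ e, 0 ≤ p e) (h1 : ∀ e, p e ≤ 1)
    {size : E → ℝ≥0} {cap : ℝ≥0} {e : E} (he : 2 * size e ≤ cap) :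
    1 - 2 * ((∑ f with ¬ cap < 2 * size f, p f * size f) / cap) ≤
      selectProb p (smallFamily size cap) e := by
  classical
  have hkey (A : Finset E) (hA : ¬ Selectable (smallFamily size cap) e A) :
      (cap : ℝ) / 2 < ∑ f ∈ A ∩ ({f | ¬ cap < 2 * size f} : Finset E), (size f : ℝ) := by
    rw [Selectable] at hA
    push Not at hA
    obtain ⟨I, hI, hIA, hne⟩ := hA
    have heI : e ∉ I := fun h => hne (by rwa [Finset.insert_eq_of_mem h])
    have hlt : cap < size e + ∑ f ∈ I, size f := by
      by_contra! hle
      refine hne ⟨fun f hf => ?_, by rwa [Finset.sum_insert heI]⟩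
      rcases Finset.mem_insert.1 hf with rfl | hf
      · exact he
      · exact hI.1 f hf
    have hsub : I ⊆ A ∩ ({f | ¬ cap < 2 * size f} : Finset E) := fun f hf =>
      Finset.mem_inter.2 ⟨hIA hf, by simpa using hI.1 f hf⟩
    have hle : ∑ f ∈ I, (size f : ℝ) ≤
        ∑ f ∈ A ∩ ({f | ¬ cap < 2 * size f} : Finset E), (size f : ℝ) :=
      Finset.sum_le_sum_of_subset_of_nonneg hsub fun f _ _ => (size f).2
    have hlt' : (cap : ℝ) < size e + ∑ f ∈ I, (size f : ℝ) := by exact_mod_cast hlt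
    have he' : 2 * (size e : ℝ) ≤ cap := by exact_mod_cast he
    linarith
  rcases eq_zero_or_pos cap with rfl | hcap
  · rw [selectProb_eq_one fun A => ?_]
    · simp
    by_contra hA
    have h := hkey A hA
    rw [Finset.sum_eq_zero] at h
    · simp at h
    · intro f hf
      have := (Finset.mem_filter.1 (Finset.mem_inter.1 hf).2).2
      simpa using this
  · have h := mul_one_sub_selectProb_le (F := smallFamily size cap) (e := e) h0 h1
      (fun f => (size f).2) fun A hA => (hkey A hA).le
    have hcap' : (0 : ℝ) < cap := by exact_mod_cast hcap
    change (cap : ℝ) / 2 * _ ≤ ∑ f with ¬ cap < 2 * size f, p f * (size f : ℝ) at h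
    have h2 : (1 - selectProb p (smallFamily size cap) e) / 2 ≤
        (∑ f with ¬ cap < 2 * size f, p f * (size f : ℝ)) / cap := by
      rw [le_div_iff₀ hcap']
      linarith
    linarith

theorem exists_isAlphaPolicy_knapsack (I : ProbingInstance E)
    (hout : I.outer = trivialSystem E) (size : E → ℝ≥0) (cap : ℝ≥0)
    (hin : I.inner = knapsackSystem size cap) :
    ∃ R, I.IsAlphaPolicy (3 / 2 - Real.sqrt 2) R := by
  classical
  refine exists_isAlphaPolicy I hout fun lam v h0 hM h1 hv => ?_
  have hp0 := coverProb_nonneg h0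
  have hp1 := coverProb_le_one h0 h1
  set p := coverProb lam with hp
  have hsq : Real.sqrt 2 ^ 2 = 2 := Real.sq_sqrt (by norm_num)
  have hs1 : (1.4 : ℝ) ≤ Real.sqrt 2 := Real.le_sqrt_of_sq_le (by norm_num)
  have hs2 : Real.sqrt 2 ≤ (1.5 : ℝ) := Real.sqrt_le_iff.2 (by norm_num)
  -- This b maximizes the worst-case guarantee b(1 − 2b)/(2 − 2b) over [0, 1/2]; the maximum is b² =
  -- 3/2 − √2.
  set b : ℝ := 1 - Real.sqrt 2 / 2 with hb
  have hb0 : 0 ≤ b := by linarith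
  have hb1 : b ≤ 1 := by linarith
  have hfit (e : E) (he : 0 < p e) : size e ≤ cap := by
    have := feasible_of_coverProb_pos hM he
    rw [hin] at this
    simpa [knapsackSystem] using this
  have hvp (e : E) (he : v e ≠ 0) : 0 < p e :=
    (hp0 e).lt_of_ne fun h => he (hv e h.symm)
  set x : ℝ := ∑ f with cap < 2 * size f, p f with hx
  set y : ℝ := (∑ f with ¬ cap < 2 * size f, p f * size f) / cap with hy
  have hx0 : 0 ≤ x := Finset.sum_nonneg fun f _ => hp0 f
  have hy0 : 0 ≤ y := div_nonneg
    (Finset.sum_nonneg fun f _ => mul_nonneg (hp0 f) (size f).2) cap.2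
  -- Expected size of `g` relative to the capacity, with each big item counted at one half. At
  -- capacity zero no big item has positive probability, and y = 0 by the convention for division.
  have hxy : x / 2 + y ≤ 1 := by
    rcases eq_zero_or_pos cap with hcap | hcap
    · have hx' : x = 0 := by
        refine Finset.sum_eq_zero fun f hf => ?_
        by_contra hne
        have hf' := hfit f ((hp0 f).lt_of_ne (Ne.symm hne))
        have := (Finset.mem_filter.1 hf).2
        rw [hcap] at hf' this
        simp [le_zero_iff.1 hf'] at this
      simp [hx', hy, hcap]
    · have hcap' : (0 : ℝ) < cap := by exact_mod_cast hcap
      have hpack := sum_coverProb_mul_le (w := fun f => (size f : ℝ)) (D := Finset.univ)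
        (c := cap) h0 hM h1 fun G hG => by
          rw [hin] at hG
          rw [Finset.filter_univ_mem]
          exact_mod_cast hG
      rw [← Finset.sum_filter_add_sum_filter_not Finset.univ
        (fun f => cap < 2 * size f)] at hpack
      have hbig : x * (cap / 2) ≤ ∑ f with cap < 2 * size f, p f * size f := by
        rw [hx, Finset.sum_mul]
        refine Finset.sum_le_sum fun f hf => mul_le_mul_of_nonneg_left ?_ (hp0 f)
        have : (cap : ℝ) < 2 * size f := by exact_mod_cast (Finset.mem_filter.1 hf).2
        linarith
      have hyc : y * cap = ∑ f with ¬ cap < 2 * size f, p f * size f :=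
        div_mul_cancel₀ _ hcap'.ne'
      refine le_of_mul_le_mul_right ?_ hcap'
      linarith
  have ha : 0 < 1 - b * x := by nlinarith
  have hd : 0 < 1 - b * (2 * y) := by nlinarith
  have had : 0 < (1 - b * x) + (1 - b * (2 * y)) := by linarith
  -- With σ = bx + 2by ≤ 2b, dropping the product term leaves 1 − σ ≥ b(2 − σ), which follows from
  -- 2b(1 − b) = 1 − 2b.
  have hα : (3 / 2 - Real.sqrt 2) * ((1 - b * x) + (1 - b * (2 * y))) ≤
      b * ((1 - b * x) * (1 - b * (2 * y))) := by
    have hα : 3 / 2 - Real.sqrt 2 = b * b := by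
      rw [hb]
      linear_combination (-1 / 4 : ℝ) * hsq
    have hquad : 2 * b * (1 - b) = 1 - 2 * b := by
      rw [hb]
      linear_combination (-1 / 2 : ℝ) * hsq
    have hσ : b * x + b * (2 * y) ≤ 2 * b := by nlinarith
    have hprod : 0 ≤ (b * x) * (b * (2 * y)) := by positivity
    rw [hα, mul_assoc]
    refine mul_le_mul_of_nonneg_left ?_ hb0
    nlinarith [mul_le_mul_of_nonneg_right hσ (sub_nonneg.2 hb1)]
  -- The mixing probability that equalizes the guarantees for big and small items.
  set π : ℝ := (1 - b * (2 * y)) / ((1 - b * x) + (1 - b * (2 * y))) with hπ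
  obtain ⟨F, hF, hineq⟩ := exists_family_of_two (p := fun f => b * p f) (v := v) (b := b)
    (α := 3 / 2 - Real.sqrt 2) (π := π) (D := ({f | cap < 2 * size f} : Finset E))
    (F₁ := bigFamily size cap) (F₂ := smallFamily size cap)
    (s₁ := 1 - b * x) (s₂ := 1 - b * (2 * y))
    (div_nonneg hd.le had.le) (div_le_one_of_le₀ (by linarith) had.le) hb0
    (by
      rw [hπ, div_mul_eq_mul_div, le_div_iff₀ had]
      linarith)
    (by
      have : 1 - π = (1 - b * x) / ((1 - b * x) + (1 - b * (2 * y))) := by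
        rw [hπ, eq_div_iff had.ne', sub_mul, div_mul_cancel₀ _ had.ne']
        ring
      rw [this, div_mul_eq_mul_div, le_div_iff₀ had]
      linarith)
    (fun e he hve => by
      have := one_sub_le_selectProb_bigFamily (p := fun f => b * p f)
        (fun f => mul_nonneg hb0 (hp0 f)) (fun f => mul_le_one₀ hb1 (hp0 f) (hp1 f))
        (Finset.mem_filter.1 he).2 (hfit e (hvp e hve))
      rwa [← Finset.mul_sum] at this)
    (fun e he hve => by
      have := one_sub_le_selectProb_smallFamily (p := fun f => b * p f)
        (fun f => mul_nonneg hb0 (hp0 f)) (fun f => mul_le_one₀ hb1 (hp0 f) (hp1 f))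
        (size := size) (cap := cap) (e := e) (by simpa using he)
      simp only [mul_assoc] at this
      rw [← Finset.mul_sum, mul_div_assoc] at this
      linarith)
  refine ⟨fun _ => b, F, fun _ => hb0, fun _ => hb1, ?_, fun T hT => ?_, hineq⟩
  · rcases hF with rfl | rfl
    · exact Or.inl rfl
    · simp [smallFamily]
  · rw [hin]
    rcases hF with rfl | rfl
    · rcases hT with rfl | ⟨e, -, he, rfl⟩
      · exact (knapsackSystem size cap).empty_feasible
      · simpa [knapsackSystem] using he
    · exact hT.2

end Knapsack

/-! ### Matroid constraints -/

section MatroidConstraint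

variable {E : Type*} [Fintype E]

/-- The rank of a set in a matroid on a finite ground set, as a real number. -/
noncomputable def realRk {E : Type*} (M : Matroid E) (X : Set E) : ℝ := ((M.eRk X).toNat : ℝ)

theorem eRk_ne_top (M : Matroid E) (X : Set E) : M.eRk X ≠ ⊤ :=
  ne_top_of_le_ne_top (Set.encard_ne_top_iff.2 X.toFinite) (M.eRk_le_encard X)

theorem realRk_insert {M : Matroid E} {e : E} {X : Set E} (he : e ∈ M.E)
    (he' : e ∉ M.closure X) : realRk M (insert e X) = realRk M X + 1 := by
  rw [realRk, M.eRk_insert_eq_add_one ⟨he, he'⟩,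
    ENat.toNat_add (eRk_ne_top M X) (by simp)]
  simp [realRk]

theorem realRk_congr {E : Type*} {M : Matroid E} {X Y : Set E} (h : M.closure X = M.closure Y) :
    realRk M X = realRk M Y := by
  rw [realRk, realRk, ← M.eRk_closure_eq X, h, M.eRk_closure_eq]

theorem realRk_insert_of_mem {E : Type*} {M : Matroid E} {e : E} {X : Set E}
    (he : e ∈ M.closure X) : realRk M (insert e X) = realRk M X :=
  realRk_congr (Matroid.closure_insert_eq_of_mem_closure he)

theorem realRk_le_card {E : Type*} (M : Matroid E) (X : Finset E) : realRk M X ≤ X.card := by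
  have h := M.eRk_le_encard (X : Set E)
  rw [Set.encard_coe_eq_coe_finsetCard] at h
  exact Nat.cast_le.2 <| ENat.toNat_le_of_le_natCast h

theorem card_le_realRk {M : Matroid E} {I : Finset E} {X : Set E} (hI : M.Indep I)
    (hIX : (I : Set E) ⊆ X) : (I.card : ℝ) ≤ realRk M X := by
  have h := hI.encard_le_eRk_of_subset hIX
  rw [Set.encard_coe_eq_coe_finsetCard] at h
  have h' := ENat.toNat_le_toNat h (eRk_ne_top M X)
  rw [ENat.toNat_natCast] at h'
  exact Nat.cast_le.2 h'

open Classical in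
/-- If `p` is `b` times a point of the matroid polytope, then some proper subset `S` of `N` is such
that the elements of `N` outside `S` are rarely spanned by `S` and the active elements. -/
theorem exists_ssubset_forall_le_sum_notMem_closure {M : Matroid E} (hE : M.E = Set.univ)
    {p : E → ℝ} (h0 : ∀ e, 0 ≤ p e) (h1 : ∀ e, p e ≤ 1) {b : ℝ} {N : Finset E}
    (hN : ∑ e ∈ N, p e ≤ b * realRk M N) (hne : ∃ e ∈ N, e ∉ M.closure ∅) :
    ∃ S ⊂ N, ∀ e ∈ N, e ∉ S →
      1 - b ≤ ∑ A with e ∉ M.closure ((A ∩ N : Finset E) ∪ S : Set E), subsetWeight p A := by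
  -- For a minimizer T of this potential, adding e outside the closure of T lowers the second term
  -- by 1 − b. The expected rank must then grow by at least 1 − b, and that growth is the
  -- probability that e is not spanned.
  let g (S : Finset E) : ℝ :=
    ∑ A, subsetWeight p A * realRk M ((A ∩ N : Finset E) ∪ S : Set E) - (1 - b) * realRk M S
  have hself (X : Set E) : X ⊆ M.closure X := M.subset_closure X (by rw [hE]; simp)
  -- A minimizer that spans N has potential b · rk N, which by `hN` is at least the potential of ∅.
  -- Then ∅ is a minimizer too, and it does not span N because N contains a non-loop.
  obtain ⟨T, hTN, hT, hTmin⟩ : ∃ T ⊆ N, ¬ (N : Set E) ⊆ M.closure T ∧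
      ∀ S ⊆ N, g T ≤ g S := by
    obtain ⟨T, hTN, hTmin⟩ := Finset.exists_min_image N.powerset g ⟨∅, by simp⟩
    rw [Finset.mem_powerset] at hTN
    by_cases hT : (N : Set E) ⊆ M.closure T
    · refine ⟨∅, by simp, fun h => ?_, fun S hS =>
        le_trans ?_ (hTmin S (Finset.mem_powerset.2 hS))⟩
      · obtain ⟨e, he, he'⟩ := hne
        exact he' (by simpa using h he)
      · have hrk : realRk M T = realRk M N := by
          refine realRk_congr (le_antisymm (M.closure_subset_closure (by exact_mod_cast hTN)) ?_)
          exact M.closure_subset_closure_of_subset_closure hT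
        have hrk' (A : Finset E) :
            realRk M ((A ∩ N : Finset E) ∪ T : Set E) = realRk M N := by
          rw [← hrk]
          refine realRk_congr (le_antisymm ?_ (M.closure_subset_closure Set.subset_union_right))
          refine M.closure_subset_closure_of_subset_closure (Set.union_subset ?_ (hself _))
          exact subset_trans (by simp) hT
        calc g ∅ ≤ ∑ A, subsetWeight p A * ∑ e ∈ A ∩ N, 1 := by
              simp only [g, Finset.coe_empty, Set.union_empty]
              have : realRk M ∅ = 0 := by simp [realRk]
              rw [this, mul_zero, sub_zero]
              refine Finset.sum_le_sum fun A _ =>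
                mul_le_mul_of_nonneg_left ?_ (subsetWeight_nonneg h0 h1 A)
              simpa using realRk_le_card M (A ∩ N)
          _ = ∑ e ∈ N, p e := by rw [sum_subsetWeight_mul_sum]; simp
          _ ≤ b * realRk M N := hN
          _ = g T := by
              simp only [g, hrk', hrk]
              rw [← Finset.sum_mul, sum_subsetWeight]
              ring
    · exact ⟨T, hTN, hT, fun S hS => hTmin S (Finset.mem_powerset.2 hS)⟩
  -- Passing to the part of N spanned by T changes no closure below, and ensures that every
  -- remaining e lies outside the closure of T.
  refine ⟨N.filter (· ∈ M.closure T), ?_, fun e he heS => ?_⟩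
  · refine (Finset.filter_ssubset).2 ?_
    simpa [Set.subset_def] using hT
  · have heT : e ∉ M.closure T := fun h => heS (Finset.mem_filter.2 ⟨he, h⟩)
    have heE : e ∈ M.E := by rw [hE]; trivial
    have hmin := hTmin (insert e T) (Finset.insert_subset he hTN)
    simp only [g, Finset.coe_insert, Set.union_insert] at hmin
    rw [realRk_insert heE heT] at hmin
    have hdiff : ∑ A, subsetWeight p A *
          realRk M (insert e ((A ∩ N : Finset E) ∪ T : Set E)) =
        ∑ A, subsetWeight p A * realRk M ((A ∩ N : Finset E) ∪ T : Set E) +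
          ∑ A with e ∉ M.closure ((A ∩ N : Finset E) ∪ T : Set E), subsetWeight p A := by
      rw [Finset.sum_filter, ← Finset.sum_add_distrib]
      refine Finset.sum_congr rfl fun A _ => ?_
      split_ifs with h
      · rw [realRk_insert_of_mem h, add_zero]
      · rw [realRk_insert heE h]
        ring
    rw [hdiff] at hmin
    have hmono : ∑ A with e ∉ M.closure ((A ∩ N : Finset E) ∪ T : Set E), subsetWeight p A ≤
        ∑ A with e ∉ M.closure
          ((A ∩ N : Finset E) ∪ (N.filter (· ∈ M.closure T) : Finset E) : Set E),
          subsetWeight p A := by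
      refine Finset.sum_le_sum_of_subset_of_nonneg
        (Finset.monotone_filter_right _ fun A _ hA h => hA ?_)
        fun A _ _ => subsetWeight_nonneg h0 h1 A
      refine M.closure_subset_closure_of_subset_closure (Set.union_subset ?_ ?_) h
      · exact Set.subset_union_left.trans (hself _)
      · intro f hf
        exact M.closure_subset_closure Set.subset_union_right (Finset.mem_filter.1 hf).2
    linarith

theorem indep_of_indep_inter_of_contract {E : Type*} {M : Matroid E} (hE : M.E = Set.univ) {I S : Set E}
    (h1 : M.Indep (I ∩ S)) (h2 : (M.contract S).Indep (I \ S)) : M.Indep I := by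
  obtain ⟨J, hJ, hIJ⟩ := h1.subset_isBasis_of_subset Set.inter_subset_right (by rw [hE]; simp)
  refine ((hJ.contract_indep_iff).1 h2).1.subset fun e he => ?_
  by_cases heS : e ∈ S
  · exact Or.inr (hIJ ⟨he, heS⟩)
  · exact Or.inl ⟨he, heS⟩

theorem insert_sdiff_indep_contract {E : Type*} {M : Matroid E} (hE : M.E = Set.univ) {I S : Set E} {e : E}
    (heS : e ∉ S) (h : (M.contract S).Indep (I \ S)) (he : e ∉ M.closure (I ∪ S)) :
    (M.contract S).Indep (insert e I \ S) := by
  rw [Set.insert_sdiff_of_notMem _ heS, h.insert_indep_iff]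
  refine Or.inl ⟨by simp [hE, heS], ?_⟩
  rw [M.contract_closure_eq, Set.sdiff_union_self]
  exact fun h => he h.1

/-- Induction on N produces a chain of subsets. For the proper subset S found above, acceptability
on S is delegated to the family for S, and the part outside S must be independent after contracting
S. Elements of S are unaffected by what is taken outside S; an element e outside S is blocked only
when S and the active elements of N span it. -/
theorem exists_family_forall_le_selectProb {M : Matroid E} (hE : M.E = Set.univ)
    {p : E → ℝ} (h0 : ∀ e, 0 ≤ p e) (h1 : ∀ e, p e ≤ 1) {b : ℝ}
    (hp : ∀ D : Finset E, ∑ e ∈ D, p e ≤ b * realRk M D) (N : Finset E) :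
    ∃ F : Set (Finset E), ∅ ∈ F ∧ (∀ I ∈ F, I ⊆ N ∧ M.Indep I) ∧
      ∀ e ∈ N, e ∉ M.closure ∅ → 1 - b ≤ selectProb p F e := by
  classical
  induction N using Finset.strongInduction with
  | H N ih =>
    by_cases hne : ∃ e ∈ N, e ∉ M.closure ∅
    · obtain ⟨S, hSN, hS⟩ := exists_ssubset_forall_le_sum_notMem_closure hE h0 h1 (hp N) hne
      obtain ⟨F, hF0, hFI, hF⟩ := ih S hSN
      refine ⟨{I | I ⊆ N ∧ I ∩ S ∈ F ∧ (M.contract (S : Set E)).Indep ((I : Set E) \ S)},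
        ⟨by simp, by simpa using hF0, by simp⟩, fun I hI => ⟨hI.1, ?_⟩, fun e he hcl => ?_⟩
      · refine indep_of_indep_inter_of_contract hE (S := (S : Set E)) ?_ hI.2.2
        exact_mod_cast (hFI _ hI.2.1).2
      · by_cases heS : e ∈ S
        · refine (hF e heS hcl).trans (Finset.sum_le_sum_of_subset_of_nonneg
            (Finset.monotone_filter_right _ fun A _ hA I hI hIA => ?_)
            fun A _ _ => subsetWeight_nonneg h0 h1 A)
          refine ⟨Finset.insert_subset he hI.1, ?_, ?_⟩
          · rw [Finset.insert_inter_of_mem heS]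
            exact hA _ hI.2.1 (Finset.inter_subset_left.trans hIA)
          · rw [Finset.coe_insert, Set.insert_sdiff_of_mem _ (Finset.mem_coe.2 heS)]
            exact hI.2.2
        · refine (hS e he heS).trans (Finset.sum_le_sum_of_subset_of_nonneg
            (Finset.monotone_filter_right _ fun A _ hA I hI hIA => ?_)
            fun A _ _ => subsetWeight_nonneg h0 h1 A)
          refine ⟨Finset.insert_subset he hI.1, ?_, ?_⟩
          · rw [Finset.insert_inter_of_notMem heS]
            exact hI.2.1
          · rw [Finset.coe_insert]
            refine insert_sdiff_indep_contract hE (by simpa using heS) hI.2.2 fun h => hA ?_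
            refine M.closure_subset_closure (Set.union_subset_union_left _ ?_) h
            exact_mod_cast Finset.subset_inter hIA hI.1
    · refine ⟨{∅}, rfl, ?_, fun e he h => absurd ⟨e, he, h⟩ hne⟩
      rintro I rfl
      simp

/-- Scaling by b gives the guarantee b(1 − b), which is largest at b = 1/2. -/
theorem exists_isAlphaPolicy_matroid (I : ProbingInstance E)
    (hout : I.outer = trivialSystem E) (M : Matroid E) (hE : M.E = Set.univ)
    (hin : I.inner = matroidSystem M) : ∃ R, I.IsAlphaPolicy (1 / 4) R := by
  classical
  refine exists_isAlphaPolicy_of_forall_le I hout fun lam h0 hM h1 => ?_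
  have hp0 := coverProb_nonneg h0
  have hp1 := coverProb_le_one h0 h1
  obtain ⟨F, hF0, hFI, hF⟩ := exists_family_forall_le_selectProb hE
    (p := fun e => 1 / 2 * coverProb lam e) (b := 1 / 2)
    (fun e => by linarith [hp0 e]) (fun e => by linarith [hp0 e, hp1 e])
    (fun D => by
      rw [← Finset.mul_sum]
      refine mul_le_mul_of_nonneg_left ?_ (by norm_num)
      have := sum_coverProb_mul_le (w := fun _ => 1) (D := D) (c := realRk M D) h0 hM h1
        fun G hG => by
          rw [hin] at hG
          have hsub : D.filter (· ∈ G) ⊆ G := fun e he => (Finset.mem_filter.1 he).2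
          have := card_le_realRk (X := (D : Set E)) (I := D.filter (· ∈ G))
            (hG.subset (Finset.coe_subset.2 hsub)) (Finset.coe_subset.2 (Finset.filter_subset _ _))
          simpa using this
      simpa using this) Finset.univ
  refine ⟨fun _ => 1 / 2, F, fun _ => by norm_num, fun _ => by norm_num, hF0, fun T hT => ?_,
    fun e he => ?_⟩
  · rw [hin]
    exact (hFI T hT).2
  · have hind := feasible_of_coverProb_pos hM he
    rw [hin] at hind
    have hind' : M.Indep {e} := by simpa [matroidSystem] using hind
    -- The closure of ∅ is the set of loops, and a loop is never in a feasible set.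
    have hcl : e ∉ M.closure ∅ := (Matroid.indep_singleton.1 hind').not_isLoop
    linarith [hF e (Finset.mem_univ e) hcl]

end MatroidConstraint

end DelegatedProbing

theorem mainTheorem4 {E : Type*} [Fintype E] (I : DelegatedProbing.ProbingInstance E)
    (hout : I.outer = DelegatedProbing.trivialSystem E) :
    (∀ M : Matroid E, M.E = Set.univ → I.inner = DelegatedProbing.matroidSystem M →
      ∃ R, I.IsAlphaPolicy (1 / 4) R) ∧
    (∀ (V : Type*) (ends : E → Sym2 V), I.inner = DelegatedProbing.matchingSystem ends →
      ∃ R, I.IsAlphaPolicy (1 / (2 * Real.exp 1)) R) ∧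
    (∀ (size : E → NNReal) (cap : NNReal), I.inner = DelegatedProbing.knapsackSystem size cap →
      ∃ R, I.IsAlphaPolicy (3 / 2 - Real.sqrt 2) R) :=
  ⟨fun M hE hin => DelegatedProbing.exists_isAlphaPolicy_matroid I hout M hE hin,
    fun _ ends hin => DelegatedProbing.exists_isAlphaPolicy_matching I hout ends hin,
    fun size cap hin => DelegatedProbing.exists_isAlphaPolicy_knapsack I hout size cap hin⟩
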